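/- Let $d\ge 1$. For $j\ge 0$ let $H_j$ be the (physicists') Hermite polynomial and $\psi_j(x)=\frac{1}{\sqrt{2^j j!\sqrt\pi}}H_j(x)e^{-x^2/2}$, $x\in\mathbb R$, and for $n\in\mathbb N$ and $x,x'\in\mathbb R^d$ let $$\mathcal K_n^{\rm Fermi}(x,x')=\sum_{\substack{j_1,\dots,j_d\ge 0\\ j_1+\dots+j_d\le n-1}}\ \prod_{k=1}^d\psi_{j_k}(x_k)\,\psi_{j_k}(x'_k),\qquad \mathbb K_n^{\rm Fermi}(X,X')=n^{d/2}\,\mathcal K_n^{\rm Fermi}(\sqrt n\,X,\sqrt n\,X').$$ Let $X\in\mathbb R^d$ be fixed with Euclidean norm $|X|<\sqrt 2$, and put $\nu(X)=2^{-d}(2-|X|^2)^{d/2}$. Then, as $n\to\infty$, $$\frac{1}{\nu(X)\,n^d}\,\mathbb K_n^{\rm Fermi}\left(X+\frac{U}{\nu(X)^{1/d}n},\,X+\frac{V}{\nu(X)^{1/d}n}\right)=\frac{J_{d/2}(2|U-V|)}{(\pi|U-V|)^{d/2}}+\mathcal O\left(\frac1n\right)$$ uniformly for $(U,V)$ in compact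 subsets of $\mathbb R^d\times\mathbb R^d$. That is, for each compact set $K\subset\mathbb R^d\times\mathbb R^d$ there are constants $C$ and $N\ge 1$ such that for all $n\ge N$ and all $(U,V)\in K$ the two sides, without the error term, differ by at most $C/n$. Here $J_{d/2}$ is the Bessel function of the first kind, and for $U=V$ the quotient $J_{d/2}(2|U-V|)/(\pi|U-V|)^{d/2}$ stands for its limit $\frac{1}{\pi^{d/2}\,\Gamma(d/2+1)}$. -/

import Mathlib

open Filter Topology

noncomputable section

/-- The (physicists') Hermite polynomial `H_n(x) = 2 ^ (n / 2) * He_n(√2 x)`, where `He_n` is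
Mathlib's (probabilists') Hermite polynomial. -/
def physHermite (n : ℕ) (x : ℝ) : ℝ :=
  (√2) ^ n * Polynomial.aeval (√2 * x) (Polynomial.hermite n)

/-- The `j`-th Hermite function, an `L²(ℝ)`-normalized eigenfunction of `-d²/dx² + x²`. -/
def hermiteFun (j : ℕ) (x : ℝ) : ℝ :=
  1 / √(2 ^ j * (Nat.factorial j : ℝ) * √Real.pi) * physHermite j x * Real.exp (-(x ^ 2) / 2)

/-- The eigenfunction `Ψ_j` of the `d`-dimensional harmonic oscillator, for a multi-index `j`. -/
def oscEigenfun {d : ℕ} (j : Fin d → ℕ) (x : EuclideanSpace ℝ (Fin d)) : ℝ :=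
  ∏ k, hermiteFun (j k) (x k)

/-- The fermion kernel: the sum of `Ψ_j(x) Ψ_j(x')` over all multi-indices
`j : Fin d → ℕ` with `j_1 + ⋯ + j_d < n`, arranged by the value `m` of `j_1 + ⋯ + j_d`. -/
def fermiKernel {d : ℕ} (n : ℕ) (x x' : EuclideanSpace ℝ (Fin d)) : ℝ :=
  ∑ m ∈ Finset.range n, ∑ j ∈ Finset.piAntidiag (Finset.univ : Finset (Fin d)) m,
    oscEigenfun j x * oscEigenfun j x'

/-- The fermion kernel on the global scale, `n ^ (d / 2) * K_n(√n X, √n X')`. -/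
def scaledFermiKernel {d : ℕ} (n : ℕ) (X X' : EuclideanSpace ℝ (Fin d)) : ℝ :=
  (n : ℝ) ^ ((d : ℝ) / 2) * fermiKernel n (√(n : ℝ) • X) (√(n : ℝ) • X')

/-- The local density factor `ν(X) = 2 ^ (-d) * (2 - |X|²) ^ (d / 2)`. -/
def bulkNu {d : ℕ} (X : EuclideanSpace ℝ (Fin d)) : ℝ :=
  (2 : ℝ) ^ (-(d : ℝ)) * (2 - ‖X‖ ^ 2) ^ ((d : ℝ) / 2)

/-- The Bessel function of the first kind `J_a(x)` of order `a ≥ 0`, for real `x ≥ 0`. -/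
def besselJ (a x : ℝ) : ℝ :=
  ∑' k : ℕ, (-1) ^ k / ((Nat.factorial k : ℝ) * Real.Gamma (k + a + 1)) *
    (x / 2) ^ (2 * (k : ℝ) + a)

/-- The `d`-dimensional sine kernel `J_{d/2}(2 r) / (π r) ^ (d / 2)` as a function of the distance
`r ≥ 0`, with its limit as the value at `r = 0`
(see `tendsto_besselJ_div` for the fact that it is the limit). -/
def sineKernel (d : ℕ) (r : ℝ) : ℝ :=
  if r = 0 then 1 / (Real.pi ^ ((d : ℝ) / 2) * Real.Gamma ((d : ℝ) / 2 + 1))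
  else besselJ ((d : ℝ) / 2) (2 * r) / (Real.pi * r) ^ ((d : ℝ) / 2)

theorem norm_besselTerm_le (a : ℝ) (ha : 0 ≤ a) (k : ℕ) (r R : ℝ) (hr : |r| ≤ R) :
    ‖(-1) ^ k / ((Nat.factorial k : ℝ) * Real.Gamma (k + a + 1)) * r ^ (2 * k)‖ ≤
      (1 / Real.Gamma (a + 1) + 1) * ((R ^ 2) ^ k / (Nat.factorial k : ℝ)) := by
  have hG : 0 < Real.Gamma (k + a + 1) := Real.Gamma_pos_of_pos (by positivity)
  have hG0 : 0 < Real.Gamma (a + 1) := Real.Gamma_pos_of_pos (by positivity)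
  have h1 : 1 / Real.Gamma (k + a + 1) ≤ 1 / Real.Gamma (a + 1) + 1 := by
    rcases Nat.eq_zero_or_pos k with rfl | hk
    · simp
    · have hk' : (1 : ℝ) ≤ k := by exact_mod_cast hk
      have h2 : Real.Gamma 2 ≤ Real.Gamma (k + a + 1) :=
        Real.Gamma_strictMonoOn_Ici.monotoneOn (by simp) (by simp; linarith) (by linarith)
      rw [Real.Gamma_two] at h2
      have h3 : 1 / Real.Gamma (k + a + 1) ≤ 1 := by
        rw [div_le_one hG]; exact h2
      have h4 : 0 < 1 / Real.Gamma (a + 1) := by positivity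
      linarith
  have h5 : |r| ^ (2 * k) ≤ (R ^ 2) ^ k := by
    rw [← pow_mul]; gcongr
  have h6 : ‖(-1) ^ k / ((Nat.factorial k : ℝ) * Real.Gamma (k + a + 1)) * r ^ (2 * k)‖ =
      1 / Real.Gamma (k + a + 1) * (|r| ^ (2 * k) / (Nat.factorial k : ℝ)) := by
    rw [norm_mul, norm_div, norm_pow, norm_pow, norm_neg, norm_one, one_pow, norm_mul,
      Real.norm_of_nonneg hG.le, Real.norm_eq_abs r, Real.norm_of_nonneg (by positivity)]
    field_simp
  rw [h6]
  gcongr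

theorem besselTerm_eq (a : ℝ) (k : ℕ) (r : ℝ) (hr : 0 < r) :
    (-1) ^ k / ((Nat.factorial k : ℝ) * Real.Gamma (k + a + 1)) *
      (2 * r / 2) ^ (2 * (k : ℝ) + a) =
    (-1) ^ k / ((Nat.factorial k : ℝ) * Real.Gamma (k + a + 1)) * r ^ (2 * k) * r ^ a := by
  have h : 2 * r / 2 = r := by ring
  rw [h, Real.rpow_add hr, show (2 * (k : ℝ)) = ((2 * k : ℕ) : ℝ) by push_cast; ring,
    Real.rpow_natCast]
  ring

/-- The Bessel series converges. -/
theorem summable_besselJ (a : ℝ) (ha : 0 ≤ a) (r : ℝ) (hr : 0 < r) :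
    Summable fun k : ℕ => (-1) ^ k / ((Nat.factorial k : ℝ) * Real.Gamma (k + a + 1)) *
      (2 * r / 2) ^ (2 * (k : ℝ) + a) := by
  simp_rw [besselTerm_eq a _ r hr]
  refine Summable.mul_right _ ?_
  refine Summable.of_norm_bounded ((Real.summable_pow_div_factorial (r ^ 2)).mul_left _)
    fun k => norm_besselTerm_le a ha k r r (abs_of_pos hr).le

/-- The value of `sineKernel` at `0` is the limit of its values at `r > 0`. -/
theorem tendsto_besselJ_div (d : ℕ) :
    Tendsto (fun r : ℝ => besselJ ((d : ℝ) / 2) (2 * r) / (Real.pi * r) ^ ((d : ℝ) / 2))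
      (𝓝[>] 0) (𝓝 (1 / (Real.pi ^ ((d : ℝ) / 2) * Real.Gamma ((d : ℝ) / 2 + 1)))) := by
  set a : ℝ := (d : ℝ) / 2 with ha_def
  have ha : 0 ≤ a := by positivity
  have key : Tendsto (fun r : ℝ => ∑' k : ℕ,
      (-1) ^ k / ((Nat.factorial k : ℝ) * Real.Gamma (k + a + 1)) * r ^ (2 * k))
      (𝓝[>] 0) (𝓝 (∑' k : ℕ,
        (-1) ^ k / ((Nat.factorial k : ℝ) * Real.Gamma (k + a + 1)) * (0 : ℝ) ^ (2 * k))) := by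
    refine tendsto_tsum_of_dominated_convergence
      (bound := fun k => (1 / Real.Gamma (a + 1) + 1) * (((1 : ℝ) ^ 2) ^ k / (Nat.factorial k : ℝ)))
      ((Real.summable_pow_div_factorial (1 ^ 2)).mul_left _) (fun k => ?_) ?_
    · refine Tendsto.mono_left ?_ nhdsWithin_le_nhds
      exact (continuous_const.mul (continuous_id.pow (2 * k))).tendsto (0 : ℝ)
    · filter_upwards [Ioc_mem_nhdsGT (zero_lt_one' ℝ)] with r hr k
      exact norm_besselTerm_le a ha k r 1 (by rw [abs_of_pos hr.1]; exact hr.2)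
  rw [tsum_eq_single 0 (fun k hk => by simp [hk])] at key
  have h2 := key.mul_const (1 / Real.pi ^ a)
  have h3 : (-1) ^ 0 / ((Nat.factorial 0 : ℝ) * Real.Gamma ((0 : ℕ) + a + 1)) * (0 : ℝ) ^ (2 * 0) *
      (1 / Real.pi ^ a) = 1 / (Real.pi ^ a * Real.Gamma (a + 1)) := by
    simp [mul_comm]
  rw [h3] at h2
  refine h2.congr' ?_
  filter_upwards [self_mem_nhdsWithin] with r hr
  have hr : 0 < r := hr
  have hra : 0 < r ^ a := Real.rpow_pos_of_pos hr a
  unfold besselJ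
  simp_rw [besselTerm_eq a _ r hr]
  rw [tsum_mul_right, Real.mul_rpow Real.pi_pos.le hr.le]
  field_simp

end

/-! Put `a = ‖x + y‖ ^ 2 / 4`, `b = ‖x - y‖ ^ 2 / 4` and `τ = (1 - r) / (1 + r)`. By Mehler's
formula the sum over `|j| = m` is the coefficient of `r ^ m` in `π ^ (-d / 2) (1 - r ^ 2) ^ (-d / 2)
exp (-a τ - b / τ)`; a factor `1 / (1 - r)` sums over `m < n`. Everything is done with formal power
series (`prod_mehlerSeries`, `fermiKernel_succ`). Expanding `exp (-b / τ)` gives, with `N = n - 1`,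
the kernel as `π ^ (-d / 2) ∑ k, (-b) ^ k / k! * moment d N (k + 3) a`, where `moment d N (k + 3)`
belongs to the power `τ ^ (-k)` (`hasSum_fermiKernel_succ`).

In the bulk scaling `a` is within `O(1)` of `n ‖X‖ ^ 2`, and `b = r ^ 2 / (2 l n)` with `r = ‖U -
V‖`, `l = 1 - ‖X‖ ^ 2 / 2`. It therefore suffices that `moment d N (k + 3) a` equals `(n l / 2) ^ (d
/ 2) (2 n l) ^ k / Γ(k + d / 2 + 1)` up to a relative error `O(1 / n)` growing at most geometrically
in `k`: the factor `k!` makes the errors summable, and the main terms add up to the Bessel series.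

The moments obey `∂ moment (k + 1) = -moment k` in `a`, and a four term recurrence in `k`
(`moment_recurrence`). For `k = 0` these combine to a third order linear equation for the density `ρ
= moment 3`, whose dominant part `(M - a / 2) ρ' + (d / 4) ρ = 0` has the semiclassical solution `(M
- a / 2) ^ (d / 2)`. An energy estimate bounds `ρ'` and `a ρ''` by the maximum of `|ρ|`
(`density_energy_bound`), so the remaining terms are a perturbation of relative order `1 / n`
(`density_asymptotic`). The initial value `ρ 0` is an explicit Gamma quotient
(`moment_zero_asymptotic`). The recurrence then carries the asymptotics from `k = 0` to all `k`
(`moment_asymptotic`). -/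

namespace FermiKernel

/-! ### Formal power series: linear equations, the Cayley transform and exponentials -/

section Formal

open PowerSeries

/-! ### First order linear differential equations for formal power series -/

/-- The equation expresses `(n + 1) w_{n+1}` through `w_0, …, w_n`, so all coefficients vanish with
the first. The resulting uniqueness is the tool for proving closed forms such as Mehler's formula.
-/
theorem eq_zero_of_derivative_eq_mul {L W : ℝ⟦X⟧} (hW : derivative ℝ W = L * W)
    (h0 : constantCoeff W = 0) : W = 0 := by
  have key : ∀ n, ∀ m ≤ n, coeff m W = 0 := by
    intro n
    induction n with
    | zero =>
      intro m hm
      obtain rfl : m = 0 := by omega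
      simpa using h0
    | succ n ih =>
      intro m hm
      rcases Nat.lt_or_ge m (n + 1) with h | h
      · exact ih m (by omega)
      · obtain rfl : m = n + 1 := by omega
        have h1 := congrArg (coeff n) hW
        rw [coeff_derivative, coeff_mul, Finset.sum_eq_zero] at h1
        · rcases mul_eq_zero.1 h1 with h2 | h2
          · exact h2
          · exact absurd h2 (by positivity)
        · intro p hp
          rw [ih p.2 (by have := Finset.HasAntidiagonal.mem_antidiagonal.1 hp; omega), mul_zero]
  ext n
  simpa using key n n le_rfl

theorem eq_of_derivative_eq_mul {L Y Z : ℝ⟦X⟧} (hY : derivative ℝ Y = L * Y)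
    (hZ : derivative ℝ Z = L * Z) (h0 : constantCoeff Y = constantCoeff Z) : Y = Z := by
  refine sub_eq_zero.1 (eq_zero_of_derivative_eq_mul (L := L) ?_ (by simp [h0]))
  rw [map_sub, hY, hZ]; ring

theorem derivative_mul_eq {L₁ L₂ Y Z : ℝ⟦X⟧} (hY : derivative ℝ Y = L₁ * Y)
    (hZ : derivative ℝ Z = L₂ * Z) : derivative ℝ (Y * Z) = (L₁ + L₂) * (Y * Z) := by
  rw [Derivation.leibniz, hY, hZ, smul_eq_mul, smul_eq_mul]; ring

theorem derivative_prod_eq {ι : Type*} (s : Finset ι) {L Y : ι → ℝ⟦X⟧}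
    (h : ∀ i, derivative ℝ (Y i) = L i * Y i) :
    derivative ℝ (∏ i ∈ s, Y i) = (∑ i ∈ s, L i) * ∏ i ∈ s, Y i := by
  classical
  induction s using Finset.induction_on with
  | empty => simp
  | insert i s hi ih =>
    rw [Finset.prod_insert hi, Finset.sum_insert hi]
    exact derivative_mul_eq (h i) ih

/-! ### The rational functions `1 / (1 + X)`, `1 / (1 - X)` and the Cayley transform -/

/-- `1 / (1 + X)` -/
noncomputable def invAdd : ℝ⟦X⟧ := (1 + X)⁻¹

/-- `1 / (1 - X)` -/
noncomputable def invSub : ℝ⟦X⟧ := (1 - X)⁻¹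

theorem invAdd_mul : invAdd * (1 + X) = 1 := PowerSeries.inv_mul_cancel _ (by simp)

theorem invSub_mul : invSub * (1 - X) = 1 := PowerSeries.inv_mul_cancel _ (by simp)

theorem derivative_invAdd : derivative ℝ invAdd = -invAdd ^ 2 := by
  simp [invAdd]

theorem derivative_invSub : derivative ℝ invSub = invSub ^ 2 := by
  simp [invSub]

@[simp] theorem constantCoeff_invAdd : constantCoeff invAdd = 1 := by simp [invAdd]

@[simp] theorem constantCoeff_invSub : constantCoeff invSub = 1 := by simp [invSub]

theorem invSub_eq_mk : invSub = mk 1 := by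
  calc invSub = (mk 1 * (1 - X)) * invSub := by rw [mk_one_mul_one_sub_eq_one, one_mul]
    _ = mk 1 * (invSub * (1 - X)) := by ring
    _ = mk 1 := by rw [invSub_mul, mul_one]

/-- The Cayley transform `(1 - X) / (1 + X)`. -/
noncomputable def cayley : ℝ⟦X⟧ := (1 - X) * invAdd

/-- The inverse `(1 + X) / (1 - X)` of the Cayley transform. -/
noncomputable def cayleyInv : ℝ⟦X⟧ := (1 + X) * invSub

theorem cayley_mul_cayleyInv : cayley * cayleyInv = 1 := by
  unfold cayley cayleyInv
  linear_combination (invSub * (1 - X)) * invAdd_mul + invSub_mul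

@[simp] theorem constantCoeff_cayley : constantCoeff cayley = 1 := by simp [cayley]

@[simp] theorem constantCoeff_cayleyInv : constantCoeff cayleyInv = 1 := by simp [cayleyInv]

theorem derivative_cayley : derivative ℝ cayley = -2 * invAdd ^ 2 := by
  unfold cayley
  rw [Derivation.leibniz, derivative_invAdd]
  simp only [map_sub, derivative_X, derivative_one, smul_eq_mul]
  linear_combination invAdd * invAdd_mul

theorem derivative_cayleyInv : derivative ℝ cayleyInv = 2 * invSub ^ 2 := by
  unfold cayleyInv
  rw [Derivation.leibniz, derivative_invSub]
  simp only [map_add, derivative_X, derivative_one, smul_eq_mul]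
  linear_combination (-invSub) * invSub_mul

/-! ### Exponentials of formal power series without constant term -/

/-- The power series `exp (t * w)`, where `w` has no constant term. -/
noncomputable def expSeries (t : ℝ) (w : ℝ⟦X⟧) : ℝ⟦X⟧ :=
  mk fun m => ∑ i ∈ Finset.range (m + 1), t ^ i / (i.factorial : ℝ) * coeff m (w ^ i)

theorem coeff_pow_eq_zero {w : ℝ⟦X⟧} (hw : constantCoeff w = 0) {m i : ℕ} (h : m < i) :
    coeff m (w ^ i) = 0 := by
  refine coeff_of_lt_order _ (lt_of_lt_of_le ?_ (le_order_pow_of_constantCoeff_eq_zero i hw))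
  exact_mod_cast h

theorem coeff_expSeries {w : ℝ⟦X⟧} (hw : constantCoeff w = 0) (t : ℝ) {m n : ℕ} (h : m ≤ n) :
    coeff m (expSeries t w) =
      ∑ i ∈ Finset.range (n + 1), t ^ i / (i.factorial : ℝ) * coeff m (w ^ i) := by
  rw [expSeries, coeff_mk]
  refine Finset.sum_subset (Finset.range_subset_range.2 (by omega)) fun i _ hi => ?_
  rw [coeff_pow_eq_zero hw (by simpa using hi), mul_zero]

theorem coeff_mul_expSeries {w : ℝ⟦X⟧} (hw : constantCoeff w = 0) (A : ℝ⟦X⟧) (t : ℝ) {m n : ℕ}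
    (h : m ≤ n) : coeff m (A * expSeries t w) =
      ∑ i ∈ Finset.range (n + 1), t ^ i / (i.factorial : ℝ) * coeff m (A * w ^ i) := by
  simp_rw [coeff_mul, Finset.mul_sum]
  rw [Finset.sum_comm]
  refine Finset.sum_congr rfl fun p hp => ?_
  have := Finset.HasAntidiagonal.mem_antidiagonal.1 hp
  rw [coeff_expSeries hw t (show p.2 ≤ n by omega), Finset.mul_sum]
  exact Finset.sum_congr rfl fun i _ => by ring

theorem constantCoeff_expSeries (t : ℝ) (w : ℝ⟦X⟧) : constantCoeff (expSeries t w) = 1 := by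
  rw [← coeff_zero_eq_constantCoeff_apply, expSeries, coeff_mk]; simp

theorem derivative_expSeries {w : ℝ⟦X⟧} (hw : constantCoeff w = 0) (t : ℝ) :
    derivative ℝ (expSeries t w) = C t * derivative ℝ w * expSeries t w := by
  ext m
  rw [coeff_derivative, coeff_mul_expSeries hw _ t le_rfl, expSeries, coeff_mk,
    Finset.sum_range_succ']
  have h0 : coeff (m + 1) (w ^ 0) = 0 := by simp [coeff_one]
  rw [h0, mul_zero, add_zero, Finset.sum_mul]
  refine Finset.sum_congr rfl fun i _ => ?_
  have h1 := congrArg (coeff m) (derivative_pow w (i + 1))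
  rw [coeff_derivative, Nat.add_sub_cancel, mul_assoc,
    show ((i + 1 : ℕ) : ℝ⟦X⟧) = C ((i : ℝ) + 1) by simp, coeff_C_mul] at h1
  rw [mul_assoc (C t), coeff_C_mul, mul_assoc, h1, mul_comm (derivative ℝ w), Nat.factorial_succ]
  push_cast
  field_simp
  ring

/-- Since `w` has no constant term, each coefficient is a polynomial in `t`, and differentiation is
termwise. -/
theorem hasDerivAt_coeff_expSeries {w : ℝ⟦X⟧} (hw : constantCoeff w = 0) (m : ℕ) (t : ℝ) :
    HasDerivAt (fun t => coeff m (expSeries t w)) (coeff m (w * expSeries t w)) t := by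
  simp_rw [coeff_expSeries hw _ m.le_succ]
  rw [coeff_mul_expSeries hw w t le_rfl]
  have h := HasDerivAt.fun_sum (u := Finset.range (m + 1 + 1)) (x := t)
    (A := fun i t => t ^ i / (i.factorial : ℝ) * coeff m (w ^ i)) fun i _ =>
      ((hasDerivAt_pow i t).div_const (i.factorial : ℝ)).mul_const (coeff m (w ^ i))
  refine h.congr_deriv ?_
  rw [Finset.sum_range_succ' _ (m + 1)]
  simp only [Nat.cast_zero, zero_mul, zero_div, add_zero]
  refine Finset.sum_congr rfl fun i _ => ?_
  rw [Nat.factorial_succ, Nat.add_sub_cancel, pow_succ' w]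
  push_cast
  field_simp

theorem hasDerivAt_coeff_mul {Y : ℝ → ℝ⟦X⟧} {B : ℝ⟦X⟧} {t : ℝ}
    (h : ∀ m, HasDerivAt (fun t => coeff m (Y t)) (coeff m (B * Y t)) t) (A : ℝ⟦X⟧) (m : ℕ) :
    HasDerivAt (fun t => coeff m (A * Y t)) (coeff m (A * B * Y t)) t := by
  simp_rw [mul_assoc A, coeff_mul m A]
  exact HasDerivAt.fun_sum fun p _ => (h p.2).const_mul _

theorem hasSum_pow_div_factorial_mul_choose (t : ℝ) (i : ℕ) :
    HasSum (fun k : ℕ => t ^ k / (k.factorial : ℝ) * (k.choose i : ℝ))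
      (t ^ i / (i.factorial : ℝ) * Real.exp t) := by
  rw [← hasSum_nat_add_iff' i, Finset.sum_eq_zero, sub_zero]
  · have h : HasSum (fun n : ℕ => t ^ n / (n.factorial : ℝ)) (Real.exp t) := by
      rw [Real.exp_eq_exp_ℝ]; exact NormedSpace.expSeries_div_hasSum_exp t
    refine (h.mul_left (t ^ i / (i.factorial : ℝ))).congr_fun ?_
    intro l
    rw [add_comm l i, Nat.cast_add_choose ℝ, pow_add]
    field_simp
  · intro k hk
    rw [Nat.choose_eq_zero_of_lt (Finset.mem_range.1 hk), Nat.cast_zero, mul_zero]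

/-- The expansion of `exp (t (1 + v))` in powers of `1 + v`, coefficient by coefficient. In the
binomial expansion only `v ^ i` with `i ≤ m` reach the coefficient `m`, so a finite sum is
interchanged with the series over `k`. -/
theorem hasSum_coeff_mul_one_add_pow {v : ℝ⟦X⟧} (hv : constantCoeff v = 0) (A : ℝ⟦X⟧) (t : ℝ)
    (m : ℕ) : HasSum (fun k : ℕ => t ^ k / (k.factorial : ℝ) * coeff m (A * (1 + v) ^ k))
      (Real.exp t * coeff m (A * expSeries t v)) := by
  have hz : ∀ i, m < i → coeff m (A * v ^ i) = 0 := fun i hi => by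
    rw [coeff_mul]
    refine Finset.sum_eq_zero fun p hp => ?_
    have := Finset.HasAntidiagonal.mem_antidiagonal.1 hp
    rw [coeff_pow_eq_zero hv (by omega), mul_zero]
  have hc : ∀ k : ℕ, coeff m (A * (1 + v) ^ k) =
      ∑ i ∈ Finset.range (m + 1), (k.choose i : ℝ) * coeff m (A * v ^ i) := fun k => by
    have h1 : coeff m (A * (1 + v) ^ k) =
        ∑ i ∈ Finset.range (k + 1), (k.choose i : ℝ) * coeff m (A * v ^ i) := by
      rw [add_comm, add_pow, Finset.mul_sum, map_sum]
      refine Finset.sum_congr rfl fun i _ => ?_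
      rw [one_pow, mul_one, ← mul_assoc, mul_comm, show (k.choose i : ℝ⟦X⟧) =
        C (k.choose i : ℝ) by simp, coeff_C_mul]
    -- Terms with `i > k` vanish by the binomial coefficient and those with `i > m` by the order of
    -- `v ^ i`; so the ranges up to `k` and up to `m` both agree with the range up to their maximum.
    have h2 : ∀ s : ℕ, k < s + 1 ∨ m < s + 1 → ∀ K, s ≤ K →
        ∑ i ∈ Finset.range (s + 1), (k.choose i : ℝ) * coeff m (A * v ^ i) =
        ∑ i ∈ Finset.range (K + 1), (k.choose i : ℝ) * coeff m (A * v ^ i) := by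
      intro s hs K hK
      refine Finset.sum_subset (Finset.range_subset_range.2 (by omega)) fun i _ hi => ?_
      have hi' : s + 1 ≤ i := by simpa using hi
      rcases hs with hs | hs
      · rw [Nat.choose_eq_zero_of_lt (by omega), Nat.cast_zero, zero_mul]
      · rw [hz i (by omega), mul_zero]
    rw [h1, h2 k (by omega) (max k m) (le_max_left _ _),
      ← h2 m (by omega) (max k m) (le_max_right _ _)]
  simp_rw [hc, Finset.mul_sum]
  rw [coeff_mul_expSeries hv A t le_rfl, Finset.mul_sum]
  refine hasSum_sum fun i _ => ?_
  have h := (hasSum_pow_div_factorial_mul_choose t i).mul_right (coeff m (A * v ^ i))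
  rw [← mul_assoc, mul_comm (Real.exp t)]
  exact h.congr_fun fun k => by ring

/-- The power series `exp (-a * (1 - X) / (1 + X))`. -/
noncomputable def expCayley (a : ℝ) : ℝ⟦X⟧ := C (Real.exp (-a)) * expSeries a (1 - cayley)

/-- The power series `exp (-b * (1 + X) / (1 - X))`. -/
noncomputable def expCayleyInv (b : ℝ) : ℝ⟦X⟧ := C (Real.exp (-b)) * expSeries (-b) (cayleyInv - 1)

theorem constantCoeff_expCayley (a : ℝ) : constantCoeff (expCayley a) = Real.exp (-a) := by
  simp [expCayley, constantCoeff_expSeries]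

theorem constantCoeff_expCayleyInv (b : ℝ) : constantCoeff (expCayleyInv b) = Real.exp (-b) := by
  simp [expCayleyInv, constantCoeff_expSeries]

theorem derivative_C_mul_eq {L Y : ℝ⟦X⟧} (h : derivative ℝ Y = L * Y) (c : ℝ) :
    derivative ℝ (C c * Y) = L * (C c * Y) := by
  rw [Derivation.leibniz, derivative_C, h, smul_zero, add_zero, smul_eq_mul]; ring

theorem derivative_expCayley (a : ℝ) :
    derivative ℝ (expCayley a) = C (2 * a) * invAdd ^ 2 * expCayley a := by
  refine derivative_C_mul_eq ?_ _
  rw [derivative_expSeries (by simp), map_sub, derivative_one, derivative_cayley, map_mul]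
  simp only [map_ofNat]
  ring

theorem derivative_expCayleyInv (b : ℝ) :
    derivative ℝ (expCayleyInv b) = -C (2 * b) * invSub ^ 2 * expCayleyInv b := by
  refine derivative_C_mul_eq ?_ _
  rw [derivative_expSeries (by simp), map_sub, derivative_one, derivative_cayleyInv, map_mul,
    map_neg]
  simp only [map_ofNat]
  ring

theorem hasDerivAt_coeff_expCayley (m : ℕ) (a : ℝ) :
    HasDerivAt (fun a => coeff m (expCayley a)) (coeff m (-cayley * expCayley a)) a := by
  simp only [expCayley, coeff_C_mul]
  have h := ((hasDerivAt_neg a).exp).mul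
    (hasDerivAt_coeff_expSeries (w := 1 - cayley) (by simp) m a)
  refine h.congr_deriv ?_
  rw [show -cayley * (C (Real.exp (-a)) * expSeries a (1 - cayley)) = C (Real.exp (-a)) *
    ((1 - cayley) * expSeries a (1 - cayley) - expSeries a (1 - cayley)) by ring, coeff_C_mul,
    map_sub]
  ring

theorem hasSum_coeff_mul_cayleyInv_pow (A : ℝ⟦X⟧) (b : ℝ) (m : ℕ) :
    HasSum (fun k : ℕ => (-b) ^ k / (k.factorial : ℝ) * coeff m (A * cayleyInv ^ k))
      (coeff m (A * expCayleyInv b)) := by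
  have h := hasSum_coeff_mul_one_add_pow (v := cayleyInv - 1) (by simp) A (-b) m
  rw [add_sub_cancel] at h
  convert h using 1
  rw [expCayleyInv, mul_left_comm, coeff_C_mul]

end Formal

/-! ### Mehler's formula and the generating function of the Fermi kernel -/

section Mehler

/-! ### Recurrences of the Hermite polynomials -/

theorem derivative_hermite_succ (n : ℕ) : Polynomial.derivative (Polynomial.hermite (n + 1)) =
    ((n : Polynomial ℤ) + 1) * Polynomial.hermite n := by
  induction n with
  | zero => simp
  | succ n ih =>
    rw [Polynomial.hermite_succ (n + 1), Polynomial.derivative_sub, Polynomial.derivative_mul, ih,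
      Polynomial.derivative_mul, Polynomial.derivative_X, Polynomial.hermite_succ n]
    simp only [Polynomial.derivative_add, Polynomial.derivative_natCast, Polynomial.derivative_one]
    push_cast
    ring

theorem physHermite_zero (x : ℝ) : physHermite 0 x = 1 := by simp [physHermite]

theorem physHermite_one (x : ℝ) : physHermite 1 x = 2 * x := by
  rw [physHermite, Polynomial.hermite_one, Polynomial.aeval_X, pow_one, ← mul_assoc,
    Real.mul_self_sqrt (by norm_num)]

theorem physHermite_add_two (n : ℕ) (x : ℝ) :
    physHermite (n + 2) x = 2 * x * physHermite (n + 1) x - 2 * (n + 1) * physHermite n x := by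
  have h : √2 * √2 = (2 : ℝ) := Real.mul_self_sqrt (by norm_num)
  rw [physHermite, Polynomial.hermite_succ, derivative_hermite_succ, physHermite, physHermite]
  simp only [map_sub, map_mul, Polynomial.aeval_X, map_add, map_natCast, map_one]
  rw [pow_succ, pow_succ]
  linear_combination (√2 ^ (n + 1) * x * (Polynomial.aeval (√2 * x)) (Polynomial.hermite (n + 1)) -
    √2 ^ n * ((n : ℝ) + 1) * (Polynomial.aeval (√2 * x)) (Polynomial.hermite n)) * h

open PowerSeries

theorem coeff_X_mul_derivative (Y : ℝ⟦X⟧) (m : ℕ) :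
    coeff m (X * derivative ℝ Y) = m * coeff m Y := by
  rcases m with _ | m
  · simp
  · rw [coeff_succ_X_mul, coeff_derivative]; push_cast; ring

/-! ### Mehler's formula -/

/-- The generating function of the products `H_j(x) H_j(y) / (2 ^ j j!)`. -/
noncomputable def mehlerSeries (x y : ℝ) : ℝ⟦X⟧ :=
  mk fun j => physHermite j x * physHermite j y / (2 ^ j * (j.factorial : ℝ))

/-- The generating function of the products `H_j(x) H_{j+1}(y) / (2 ^ j j!)`. -/
noncomputable def mehlerShift (x y : ℝ) : ℝ⟦X⟧ :=
  mk fun j => physHermite j x * physHermite (j + 1) y / (2 ^ j * (j.factorial : ℝ))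

theorem mehlerShift_add (x y : ℝ) :
    mehlerShift x y + X * mehlerShift y x = C (2 * y) * mehlerSeries x y := by
  ext m
  rw [map_add, coeff_C_mul, mehlerShift, mehlerShift, mehlerSeries, coeff_mk, coeff_mk]
  rcases m with _ | m
  · simp [physHermite_zero, physHermite_one]
  · rw [coeff_succ_X_mul, coeff_mk, physHermite_add_two, Nat.factorial_succ]
    push_cast
    field_simp
    ring

/-- The three term recurrence in both variables, compared coefficientwise. With `mehlerShift_add` it
forms a closed linear system for the two series, from which `mehlerShift` can be eliminated. -/
theorem derivative_mehlerSeries_aux (x y : ℝ) : derivative ℝ (mehlerSeries x y) =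
    (C x - C y * X) * mehlerShift x y +
      X * (mehlerSeries x y + X * derivative ℝ (mehlerSeries x y)) := by
  ext m
  rw [coeff_derivative, map_add, sub_mul, map_sub, coeff_C_mul, mul_assoc (C y), coeff_C_mul]
  rcases m with _ | m
  · simp [mehlerSeries, mehlerShift, physHermite_zero, physHermite_one]
    ring
  · rw [coeff_succ_X_mul, coeff_succ_X_mul, map_add, coeff_X_mul_derivative]
    simp only [mehlerSeries, mehlerShift, coeff_mk]
    rw [physHermite_add_two m x, physHermite_add_two m y, Nat.factorial_succ (m + 1),
      Nat.factorial_succ m]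
    push_cast
    field_simp
    ring

theorem derivative_mehlerSeries (x y : ℝ) : derivative ℝ (mehlerSeries x y) =
    (X * (invAdd * invSub) + C (2 * ((x + y) ^ 2 / 4)) * invAdd ^ 2 +
      -C (2 * ((x - y) ^ 2 / 4)) * invSub ^ 2) * mehlerSeries x y := by
  have h1 := derivative_mehlerSeries_aux x y
  have h2 := mehlerShift_add x y
  have h3 := mehlerShift_add y x
  rw [show mehlerSeries y x = mehlerSeries x y by
    ext; simp only [mehlerSeries, coeff_mk]; ring] at h3
  set A := mehlerSeries x y
  set B := mehlerShift x y
  set B' := mehlerShift y x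
  set p := invAdd with hp
  set m := invSub with hm
  have hpm : p * m * (1 - X ^ 2) = 1 := by
    linear_combination (m * (1 - X)) * invAdd_mul + invSub_mul
  -- `mehlerShift_add` for `(x, y)` and for `(y, x)` are two linear equations for `B` and `B'`; this
  -- is the solution for `B`.
  have hB : (1 - X ^ 2) * B = 2 * (C y - C x * X) * A := by
    simp only [map_mul, map_ofNat] at h2 h3
    linear_combination h2 - X * h3
  have hA : (1 - X ^ 2) ^ 2 * derivative ℝ A =
      (X * (1 - X ^ 2) + 2 * (C x - C y * X) * (C y - C x * X)) * A := by
    linear_combination (1 - X ^ 2) * h1 + (C x - C y * X) * hB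
  -- Partial fractions: the logarithmic derivative splits into a part in `x + y` and a part in `x -
  -- y`, which is what makes the product over coordinates depend on norms only.
  have h4 : C (2 * ((x + y) ^ 2 / 4)) * (1 - X) ^ 2 - C (2 * ((x - y) ^ 2 / 4)) * (1 + X) ^ 2 =
      2 * (C x - C y * X) * (C y - C x * X) := by
    have e1 : C (2 * ((x + y) ^ 2 / 4)) = C (1 / 2) * (C x + C y) ^ 2 := by
      rw [← map_add, ← map_pow, ← map_mul]; congr 1; ring
    have e2 : C (2 * ((x - y) ^ 2 / 4)) = C (1 / 2) * (C x - C y) ^ 2 := by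
      rw [← map_sub, ← map_pow, ← map_mul]; congr 1; ring
    have e3 : (2 : ℝ⟦X⟧) * C (1 / 2) = 1 := by
      rw [← map_ofNat (C (R := ℝ)) 2, ← map_mul]; norm_num
    rw [e1, e2]
    linear_combination (2 * C x * C y * (1 + X ^ 2) - 2 * (C x ^ 2 + C y ^ 2) * X) * e3
  have hp2 : p ^ 2 = (p * m) ^ 2 * (1 - X) ^ 2 := by
    linear_combination (-p ^ 2 * (m * (1 - X) + 1)) * invSub_mul
  have hm2 : m ^ 2 = (p * m) ^ 2 * (1 + X) ^ 2 := by
    linear_combination (-m ^ 2 * (p * (1 + X) + 1)) * invAdd_mul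
  rw [hp2, hm2]
  linear_combination (p * m) ^ 2 * hA + ((p * m) ^ 2 * A) * (-h4)
    - (derivative ℝ A * (p * m * (1 - X ^ 2) + 1) - X * p * m * A) * hpm

/-- The coefficients of `(1 - X ^ 2) ^ (-δ)`. -/
noncomputable def evenBinomialCoeff (δ : ℝ) : ℕ → ℝ
  | 0 => 1
  | 1 => 0
  | m + 2 => (m + 2 * δ) / (m + 2) * evenBinomialCoeff δ m

/-- The power series `(1 - X ^ 2) ^ (-δ)`. -/
noncomputable def evenBinomial (δ : ℝ) : ℝ⟦X⟧ := mk (evenBinomialCoeff δ)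

theorem constantCoeff_evenBinomial (δ : ℝ) : constantCoeff (evenBinomial δ) = 1 := by
  rw [← coeff_zero_eq_constantCoeff_apply, evenBinomial, coeff_mk, evenBinomialCoeff]

theorem derivative_evenBinomial (δ : ℝ) : derivative ℝ (evenBinomial δ) =
    C (2 * δ) * (X * (invAdd * invSub)) * evenBinomial δ := by
  have h : derivative ℝ (evenBinomial δ) =
      X * (X * derivative ℝ (evenBinomial δ) + C (2 * δ) * evenBinomial δ) := by
    ext m
    rw [coeff_derivative]
    rcases m with _ | m
    · simp [evenBinomial, evenBinomialCoeff]
    · rw [coeff_succ_X_mul, map_add, coeff_X_mul_derivative, coeff_C_mul]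
      simp only [evenBinomial, coeff_mk, evenBinomialCoeff]
      push_cast
      field_simp
      ring
  have hpm : invAdd * invSub * (1 - X ^ 2) = 1 := by
    linear_combination (invSub * (1 - X)) * invAdd_mul + invSub_mul
  linear_combination (invAdd * invSub) * h - derivative ℝ (evenBinomial δ) * hpm

/-- Multiplying numerator and denominator by `1 + X` makes the remaining factor even, so that its
coefficients are explicit. This serves to evaluate the moments at `a = 0`. -/
theorem invSub_mul_evenBinomial (δ : ℝ) :
    invSub * evenBinomial δ = (1 + X) * evenBinomial (δ + 1) := by
  have h1 : derivative ℝ invSub = invSub * invSub := by rw [derivative_invSub]; ring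
  have h2 : derivative ℝ (1 + X : ℝ⟦X⟧) = invAdd * (1 + X) := by
    rw [invAdd_mul]; simp
  refine eq_of_derivative_eq_mul (derivative_mul_eq h1 (derivative_evenBinomial δ)) ?_
    (by simp [constantCoeff_evenBinomial])
  rw [derivative_mul_eq h2 (derivative_evenBinomial (δ + 1))]
  have h3 : invAdd + 2 * (X * (invAdd * invSub)) = invSub := by
    linear_combination invSub * invAdd_mul - invAdd * invSub_mul
  have h4 : C (2 * (δ + 1)) = C (2 * δ) + 2 := by
    rw [mul_add, map_add, mul_one]; exact congrArg _ (map_ofNat (C (R := ℝ)) 2)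
  rw [h4]
  congr 1
  linear_combination h3

theorem invAdd_mul_evenBinomial (δ : ℝ) :
    invAdd * evenBinomial δ = (1 - X) * evenBinomial (δ + 1) := by
  linear_combination (invAdd * (1 - X)) * invSub_mul_evenBinomial δ
    - (invAdd * evenBinomial δ) * invSub_mul + ((1 - X) * evenBinomial (δ + 1)) * invAdd_mul

/-- The generating function `∑ m, r ^ m * ∑_{|j| = m} Ψ_j(x) Ψ_j(y)` of the `d`-dimensional
oscillator in closed form. -/
theorem prod_mehlerSeries {d : ℕ} (x y : EuclideanSpace ℝ (Fin d)) :
    C (Real.exp (-(‖x + y‖ ^ 2 / 4) - ‖x - y‖ ^ 2 / 4)) * ∏ k, mehlerSeries (x k) (y k) =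
      evenBinomial ((d : ℝ) / 2) * expCayley (‖x + y‖ ^ 2 / 4) *
        expCayleyInv (‖x - y‖ ^ 2 / 4) := by
  have hs : ∀ z : EuclideanSpace ℝ (Fin d), ‖z‖ ^ 2 = ∑ k, z k ^ 2 := fun z => by
    rw [EuclideanSpace.norm_sq_eq]; simp
  refine eq_of_derivative_eq_mul (derivative_C_mul_eq (derivative_prod_eq Finset.univ
    fun k => derivative_mehlerSeries (x k) (y k)) _) ?_ ?_
  · rw [derivative_mul_eq (derivative_mul_eq (derivative_evenBinomial _) (derivative_expCayley _))
      (derivative_expCayleyInv _)]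
    congr 1
    rw [Finset.sum_add_distrib, Finset.sum_add_distrib, Finset.sum_const, ← Finset.sum_mul,
      ← Finset.sum_mul, hs, hs, Finset.sum_neg_distrib, ← map_sum, ← map_sum]
    simp only [PiLp.add_apply, PiLp.sub_apply, ← Finset.mul_sum, ← Finset.sum_div]
    congr 3
    rw [Finset.card_univ, Fintype.card_fin, nsmul_eq_mul, mul_div_cancel₀ _ (two_ne_zero' ℝ)]
    simp
  · have h1 : ∀ k, constantCoeff (mehlerSeries (x k) (y k)) = 1 := fun k => by
      rw [← coeff_zero_eq_constantCoeff_apply, mehlerSeries, coeff_mk]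
      simp [physHermite_zero]
    simp only [map_mul, map_prod, h1, constantCoeff_evenBinomial, constantCoeff_expCayley,
      constantCoeff_expCayleyInv, constantCoeff_C, Finset.prod_const_one]
    rw [sub_eq_add_neg, Real.exp_add]
    ring

theorem hermiteFun_mul (j : ℕ) (x y : ℝ) : hermiteFun j x * hermiteFun j y =
    1 / √Real.pi * Real.exp (-(x ^ 2 + y ^ 2) / 2) * coeff j (mehlerSeries x y) := by
  have h : (0 : ℝ) < 2 ^ j * (j.factorial : ℝ) * √Real.pi := by positivity
  rw [mehlerSeries, coeff_mk, hermiteFun, hermiteFun,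
    show -(x ^ 2 + y ^ 2) / 2 = -(x ^ 2) / 2 + -(y ^ 2) / 2 by ring, Real.exp_add]
  have hs := Real.sq_sqrt h.le
  have hs0 := (Real.sqrt_pos.2 h).ne'
  rw [eq_comm]
  have hpi : √Real.pi ≠ 0 := (Real.sqrt_pos.2 Real.pi_pos).ne'
  have h5 : 1 / √Real.pi * (1 / (2 ^ j * (j.factorial : ℝ))) =
      1 / √(2 ^ j * (j.factorial : ℝ) * √Real.pi) * (1 / √(2 ^ j * (j.factorial : ℝ) * √Real.pi)) := by
    rw [div_mul_div_comm, div_mul_div_comm, ← sq (√(2 ^ j * (j.factorial : ℝ) * √Real.pi)), hs]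
    ring
  linear_combination (physHermite j x * physHermite j y * Real.exp (-(x ^ 2) / 2) *
    Real.exp (-(y ^ 2) / 2)) * h5

theorem sum_piAntidiag_oscEigenfun {d : ℕ} (m : ℕ) (x y : EuclideanSpace ℝ (Fin d)) :
    ∑ j ∈ Finset.piAntidiag (Finset.univ : Finset (Fin d)) m, oscEigenfun j x * oscEigenfun j y =
      (1 / √Real.pi) ^ d * coeff m (C (Real.exp (-(‖x + y‖ ^ 2 / 4) - ‖x - y‖ ^ 2 / 4)) *
        ∏ k, mehlerSeries (x k) (y k)) := by
  have hs : ∀ z : EuclideanSpace ℝ (Fin d), ‖z‖ ^ 2 = ∑ k, z k ^ 2 := fun z => by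
    rw [EuclideanSpace.norm_sq_eq]; simp
  have he : Real.exp (-(‖x + y‖ ^ 2 / 4) - ‖x - y‖ ^ 2 / 4) =
      ∏ k, Real.exp (-(x k ^ 2 + y k ^ 2) / 2) := by
    rw [← Real.exp_sum, hs, hs, Finset.sum_div, Finset.sum_div, ← Finset.sum_neg_distrib,
      ← Finset.sum_sub_distrib]
    congr 1
    refine Finset.sum_congr rfl fun k _ => ?_
    simp only [PiLp.add_apply, PiLp.sub_apply]
    ring
  have hp : ∀ j : Fin d → ℕ, oscEigenfun j x * oscEigenfun j y =
      (1 / √Real.pi) ^ d * Real.exp (-(‖x + y‖ ^ 2 / 4) - ‖x - y‖ ^ 2 / 4) *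
        ∏ k, coeff (j k) (mehlerSeries (x k) (y k)) := fun j => by
    rw [oscEigenfun, oscEigenfun, ← Finset.prod_mul_distrib, he]
    simp_rw [hermiteFun_mul]
    rw [Finset.prod_mul_distrib, Finset.prod_mul_distrib, Finset.prod_const, Finset.card_univ,
      Fintype.card_fin]
  rw [coeff_C_mul, coeff_prod, ← mul_assoc, Finset.mul_sum]
  simp_rw [hp]
  refine Finset.sum_bij' (fun j _ => Finsupp.equivFunOnFinite.symm j) (fun l _ => ⇑l) ?_ ?_ ?_ ?_ ?_
  · intro j hj
    have := Finset.mem_piAntidiag.1 hj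
    rw [Finset.mem_finsuppAntidiag]
    exact ⟨by simpa using this.1, by simp⟩
  · intro l hl
    have := Finset.mem_finsuppAntidiag.1 hl
    rw [Finset.mem_piAntidiag]
    exact ⟨by simpa using this.1, by simp⟩
  · intro j _; rfl
  · intro l _; ext; rfl
  · intro j _; rfl

/-- The power series `(1 - X) ^ (-1) (1 - X ^ 2) ^ (-d / 2) exp (-a τ)`, where
`τ = (1 - X) / (1 + X)`. -/
noncomputable def densitySeries (d : ℕ) (a : ℝ) : ℝ⟦X⟧ :=
  invSub * evenBinomial ((d : ℝ) / 2) * expCayley a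

/-- Multiplication by `1 / (1 - X)` forms partial sums. The levels `0, …, N` of the kernel with
index `N + 1` give the coefficient `N`. -/
theorem fermiKernel_succ {d : ℕ} (N : ℕ) (x y : EuclideanSpace ℝ (Fin d)) :
    fermiKernel (N + 1) x y = (1 / √Real.pi) ^ d *
      coeff N (densitySeries d (‖x + y‖ ^ 2 / 4) * expCayleyInv (‖x - y‖ ^ 2 / 4)) := by
  rw [fermiKernel, densitySeries]
  simp_rw [sum_piAntidiag_oscEigenfun, prod_mehlerSeries]
  rw [mul_assoc invSub, mul_assoc invSub, ← Finset.mul_sum, invSub_eq_mk, coeff_mul]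
  congr 1
  rw [Finset.Nat.sum_antidiagonal_eq_sum_range_succ
    (fun i j => coeff i (mk 1 : ℝ⟦X⟧) * coeff j (evenBinomial ((d : ℝ) / 2) *
      expCayley (‖x + y‖ ^ 2 / 4) * expCayleyInv (‖x - y‖ ^ 2 / 4))), ← Finset.sum_range_reflect]
  refine Finset.sum_congr rfl fun j hj => ?_
  simp

end Mehler

/-! ### The moments: derivatives, recurrence and values at zero -/

section Moments

open PowerSeries

/-- The coefficient of `X ^ N` in `τ ^ (3 - k) (1 - X) ^ (-1) (1 - X ^ 2) ^ (-d / 2) exp (-a τ)`,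
where `τ = (1 - X) / (1 + X)`. -/
noncomputable def moment (d N k : ℕ) (a : ℝ) : ℝ :=
  coeff N (cayley ^ 3 * cayleyInv ^ k * densitySeries d a)

/-- The index starts at 3 because `moment` includes the factor `τ ^ 3`; the indices 2, 1, 0 are
reserved for the first three derivatives of the density, up to sign. -/
theorem hasSum_fermiKernel_succ {d : ℕ} (N : ℕ) (x y : EuclideanSpace ℝ (Fin d)) :
    HasSum (fun k : ℕ => (1 / √Real.pi) ^ d * ((-(‖x - y‖ ^ 2 / 4)) ^ k / (k.factorial : ℝ) *
      moment d N (k + 3) (‖x + y‖ ^ 2 / 4))) (fermiKernel (N + 1) x y) := by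
  rw [fermiKernel_succ]
  refine ((hasSum_coeff_mul_cayleyInv_pow (densitySeries d (‖x + y‖ ^ 2 / 4))
    (‖x - y‖ ^ 2 / 4) N).mul_left _).congr_fun fun k => ?_
  have h : cayley ^ 3 * cayleyInv ^ (k + 3) = cayleyInv ^ k := by
    rw [pow_add, mul_left_comm, ← mul_pow, cayley_mul_cayleyInv, one_pow, mul_one]
  rw [moment, h, mul_comm (cayleyInv ^ k)]

theorem hasDerivAt_moment (d N k : ℕ) (a : ℝ) :
    HasDerivAt (moment d N (k + 1)) (-moment d N k a) a := by
  have h := hasDerivAt_coeff_mul (Y := expCayley) (B := -cayley) (t := a)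
    (fun m => hasDerivAt_coeff_expCayley m a)
    (cayley ^ 3 * cayleyInv ^ (k + 1) * (invSub * evenBinomial ((d : ℝ) / 2))) N
  have e : ∀ j a, moment d N j a = coeff N (cayley ^ 3 * cayleyInv ^ j *
      (invSub * evenBinomial ((d : ℝ) / 2)) * expCayley a) := fun j a => by
    rw [moment, densitySeries, ← mul_assoc]
  rw [funext (e (k + 1)), e k, ← map_neg]
  refine h.congr_deriv (congrArg _ ?_)
  linear_combination (-(cayley ^ 3 * cayleyInv ^ k * (invSub * evenBinomial ((d : ℝ) / 2)) *
    expCayley a)) * cayley_mul_cayleyInv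

theorem X_mul_derivative_densitySeries (d : ℕ) (a : ℝ) :
    X * derivative ℝ (densitySeries d a) = (C (1 / 2) * (cayleyInv - 1) +
      C ((d : ℝ) / 4) * (cayleyInv - 2 + cayley) + C (a / 2) * (1 - cayley ^ 2)) *
        densitySeries d a := by
  have h1 : derivative ℝ invSub = invSub * invSub := by rw [derivative_invSub]; ring
  rw [densitySeries, derivative_mul_eq (derivative_mul_eq h1 (derivative_evenBinomial _))
    (derivative_expCayley a), ← mul_assoc X]
  congr 1
  have e0 : (2 : ℝ⟦X⟧) * C (1 / 2) = 1 := by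
    rw [← map_ofNat (C (R := ℝ)) 2, ← map_mul]; norm_num
  have e1 : C (2 * ((d : ℝ) / 2)) = 4 * C ((d : ℝ) / 4) := by
    rw [← map_ofNat (C (R := ℝ)) 4, ← map_mul]; congr 1; ring
  have e2 : C (2 * a) = 4 * C (a / 2) := by
    rw [← map_ofNat (C (R := ℝ)) 4, ← map_mul]; congr 1; ring
  have hX : (X : ℝ⟦X⟧) * invSub = C (1 / 2) * (cayleyInv - 1) := by
    unfold cayleyInv
    linear_combination (-(X * invSub)) * e0 - C (1 / 2) * invSub_mul
  have hm := invSub_mul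
  have hp := invAdd_mul
  have h3 : 4 * X ^ 2 * (invAdd * invSub) = cayleyInv - 2 + cayley := by
    unfold cayley cayleyInv
    linear_combination (1 + X) * invSub * hp + (1 - X) * invAdd * hm
      - 2 * invSub * (1 - X) * hp - 2 * hm
  have h4 : 4 * X * invAdd ^ 2 = 1 - cayley ^ 2 := by
    unfold cayley
    linear_combination (1 + (1 + X) * invAdd) * hp
  rw [e1, e2, ← hX, ← h3, ← h4]
  ring

theorem X_mul_derivative_cayleyInv :
    X * derivative ℝ cayleyInv = C (1 / 2) * (cayleyInv ^ 2 - 1) := by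
  have e0 : (2 : ℝ⟦X⟧) * C (1 / 2) = 1 := by
    rw [← map_ofNat (C (R := ℝ)) 2, ← map_mul]; norm_num
  rw [derivative_cayleyInv]
  unfold cayleyInv
  linear_combination (-2 * X * invSub ^ 2) * e0 - C (1 / 2) * (1 + invSub * (1 - X)) * invSub_mul

theorem X_mul_derivative_cayley :
    X * derivative ℝ cayley = C (1 / 2) * (cayley ^ 2 - 1) := by
  have e0 : (2 : ℝ⟦X⟧) * C (1 / 2) = 1 := by
    rw [← map_ofNat (C (R := ℝ)) 2, ← map_mul]; norm_num
  rw [derivative_cayley]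
  unfold cayley
  linear_combination (2 * X * invAdd ^ 2) * e0 - C (1 / 2) * (1 + invAdd * (1 + X)) * invAdd_mul

/-- The four term recurrence of the moments. -/
theorem moment_recurrence (d N k : ℕ) (a : ℝ) :
    ((k : ℝ) / 2 + d / 4) * moment d N (k + 3) a =
      (N + 1 / 2 + d / 2 - a / 2) * moment d N (k + 2) a +
        (((k : ℝ) - 1) / 2 - d / 4) * moment d N (k + 1) a + a / 2 * moment d N k a := by
  -- The operator `X d/dX` multiplies the coefficient `N` by `N`. On the other hand its action on `τ
  -- ^ (1 - k)` times the density series is multiplication by a Laurent polynomial in `τ`, which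
  -- involves the four powers belonging to `k, …, k + 3`.
  have h := coeff_X_mul_derivative (cayley ^ 3 * cayleyInv ^ (k + 2) * densitySeries d a) N
  have hD : X * derivative ℝ (cayley ^ 3 * cayleyInv ^ (k + 2) * densitySeries d a) =
      C ((k : ℝ) / 2 + d / 4) * (cayley ^ 3 * cayleyInv ^ (k + 3) * densitySeries d a) +
      C (a / 2 - 1 / 2 - d / 2) * (cayley ^ 3 * cayleyInv ^ (k + 2) * densitySeries d a) +
      C ((d : ℝ) / 4 - (k - 1) / 2) * (cayley ^ 3 * cayleyInv ^ (k + 1) * densitySeries d a) -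
      C (a / 2) * (cayley ^ 3 * cayleyInv ^ k * densitySeries d a) := by
    have hG := X_mul_derivative_densitySeries d a
    have hs := X_mul_derivative_cayleyInv
    have ht := X_mul_derivative_cayley
    have hts := cayley_mul_cayleyInv
    simp only [Derivation.leibniz, derivative_pow, smul_eq_mul,
      show k + 2 - 1 = k + 1 by omega]
    set s := cayleyInv
    set t := cayley
    set G := densitySeries d a
    have c1 : C ((k : ℝ) / 2 + d / 4) = C (1 / 2) * (k : ℝ⟦X⟧) + C ((d : ℝ) / 4) := by
      rw [← map_natCast (C (R := ℝ)) k, ← map_mul, ← map_add]; congr 1; ring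
    have c2 : C (a / 2 - 1 / 2 - d / 2) = C (a / 2) - C (1 / 2) - 2 * C ((d : ℝ) / 4) := by
      rw [← map_ofNat (C (R := ℝ)) 2, ← map_mul, ← map_sub, ← map_sub]; congr 1; ring
    have c3 : C ((d : ℝ) / 4 - (k - 1) / 2) =
        C ((d : ℝ) / 4) - C (1 / 2) * ((k : ℝ⟦X⟧) - 1) := by
      rw [← map_natCast (C (R := ℝ)) k, ← map_one (C (R := ℝ)), ← map_sub, ← map_mul, ← map_sub]
      congr 1; ring
    rw [c1, c2, c3]
    push_cast
    have hq : ∀ j, t ^ 3 * s ^ (j + 1) = t ^ 2 * s ^ j := fun j => by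
      linear_combination (t ^ 2 * s ^ j) * hts
    clear_value s t G
    have hq2 : ∀ j, t ^ 4 * s ^ (j + 1) = t ^ 3 * s ^ j := fun j => by
      linear_combination (t ^ 3 * s ^ j) * hts
    have hq3 : ∀ j, t ^ 5 * s ^ (j + 2) = t ^ 3 * s ^ j := fun j => by
      linear_combination (t ^ 3 * s ^ j) * (t * s + 1) * hts
    linear_combination t ^ 3 * s ^ (k + 2) * hG + G * t ^ 3 * ((k : ℝ⟦X⟧) + 2) * s ^ (k + 1) * hs +
      3 * G * s ^ (k + 2) * t ^ 2 * ht + (C ((d : ℝ) / 4) + 3 * C (1 / 2)) * G * hq2 (k + 1) -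
      C (a / 2) * G * hq3 k + 3 * C (1 / 2) * G * hq (k + 2)
  rw [hD, map_sub, map_add, map_add, coeff_C_mul, coeff_C_mul, coeff_C_mul, coeff_C_mul] at h
  simp only [moment]
  linear_combination h

theorem moment_three_zero (d N : ℕ) : moment d (N + 1) 3 0 =
    evenBinomialCoeff ((d : ℝ) / 2 + 1) (N + 1) + evenBinomialCoeff ((d : ℝ) / 2 + 1) N := by
  have hE : expCayley 0 = 1 := by
    refine eq_of_derivative_eq_mul (L := 0) ?_ ?_ (by simp [constantCoeff_expCayley])
    · rw [derivative_expCayley]; simp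
    · simp
  rw [moment, densitySeries, hE, ← mul_pow, cayley_mul_cayleyInv, one_pow, one_mul, mul_one,
    invSub_mul_evenBinomial, add_mul, one_mul, map_add, coeff_succ_X_mul]
  simp [evenBinomial]

theorem moment_two_zero (d N : ℕ) : moment d (N + 1) 2 0 =
    evenBinomialCoeff ((d : ℝ) / 2 + 1) (N + 1) - evenBinomialCoeff ((d : ℝ) / 2 + 1) N := by
  have hE : expCayley 0 = 1 := by
    refine eq_of_derivative_eq_mul (L := 0) ?_ ?_ (by simp [constantCoeff_expCayley])
    · rw [derivative_expCayley]; simp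
    · simp
  have h : cayley ^ 3 * cayleyInv ^ 2 * (invSub * evenBinomial ((d : ℝ) / 2) * 1) =
      (1 - X) * evenBinomial ((d : ℝ) / 2 + 1) := by
    rw [← invAdd_mul_evenBinomial, mul_one]
    have h1 : cayley * invSub = invAdd := by
      unfold cayley; linear_combination invAdd * invSub_mul
    linear_combination (cayley * (cayley * cayleyInv + 1) * (invSub * evenBinomial ((d : ℝ) / 2)))
      * cayley_mul_cayleyInv + evenBinomial ((d : ℝ) / 2) * h1
  rw [moment, densitySeries, hE, h, sub_mul, one_mul, map_sub, coeff_succ_X_mul]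
  simp [evenBinomial]

end Moments

/-! ### Gamma quotients and the density at `a = 0` -/

section GammaRatio

theorem evenBinomialCoeff_even {δ : ℝ} (hδ : 0 ≤ δ) (q : ℕ) :
    evenBinomialCoeff (δ + 1) (2 * q) =
      Real.Gamma (q + 1 + δ) / (q.factorial : ℝ) / Real.Gamma (δ + 1) := by
  have hG : Real.Gamma (δ + 1) ≠ 0 := (Real.Gamma_pos_of_pos (by linarith)).ne'
  induction q with
  | zero =>
    simp only [evenBinomialCoeff, Nat.cast_zero, zero_add, Nat.factorial_zero,
      Nat.cast_one, div_one]
    rw [add_comm 1 δ, div_self hG]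
  | succ q ih =>
    rw [show 2 * (q + 1) = 2 * q + 2 by ring, evenBinomialCoeff, ih, Nat.factorial_succ,
      show ((q + 1 : ℕ) : ℝ) + 1 + δ = (q + 1 + δ) + 1 by push_cast; ring,
      Real.Gamma_add_one (by positivity : (0 : ℝ) < q + 1 + δ).ne']
    generalize Real.Gamma (δ + 1) = G at hG
    generalize Real.Gamma (q + 1 + δ) = G'
    push_cast
    field_simp
    ring

theorem evenBinomialCoeff_odd (δ : ℝ) (q : ℕ) : evenBinomialCoeff δ (2 * q + 1) = 0 := by
  induction q with
  | zero => simp [evenBinomialCoeff]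
  | succ q ih =>
    rw [show 2 * (q + 1) + 1 = (2 * q + 1) + 2 by ring, evenBinomialCoeff, ih, mul_zero]

/-- Log-convexity of `Γ` gives `Γ(x + 1/2) ^ 2 ≤ Γ(x) Γ(x + 1)`; the two bounds are the cases `x = q
+ 1/2` and `x = q + 1`. -/
theorem gamma_half_ratio_sq (q : ℕ) :
    (q : ℝ) + 1 / 2 ≤ (Real.Gamma (q + 1 + 1 / 2) / (q.factorial : ℝ)) ^ 2 ∧
      (Real.Gamma (q + 1 + 1 / 2) / (q.factorial : ℝ)) ^ 2 ≤ q + 1 := by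
  have key : ∀ x : ℝ, 0 < x →
      Real.Gamma (x + 1 / 2) ^ 2 ≤ Real.Gamma x * Real.Gamma (x + 1) := fun x hx => by
    have h := Real.Gamma_mul_add_mul_le_rpow_Gamma_mul_rpow_Gamma hx (show 0 < x + 1 by linarith)
      (show (0 : ℝ) < 1 / 2 by norm_num) (show (0 : ℝ) < 1 / 2 by norm_num) (by norm_num)
    have h0 := Real.Gamma_pos_of_pos hx
    have h1 := Real.Gamma_pos_of_pos (show 0 < x + 1 by linarith)
    rw [show 1 / 2 * x + 1 / 2 * (x + 1) = x + 1 / 2 by ring, ← Real.sqrt_eq_rpow,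
      ← Real.sqrt_eq_rpow, ← Real.sqrt_mul h0.le] at h
    calc Real.Gamma (x + 1 / 2) ^ 2 ≤ √(Real.Gamma x * Real.Gamma (x + 1)) ^ 2 := by
          have := Real.Gamma_pos_of_pos (show 0 < x + 1 / 2 by linarith)
          gcongr
      _ = _ := Real.sq_sqrt (by positivity)
  have hq : (0 : ℝ) < q.factorial := by positivity
  have e1 : Real.Gamma (q + 1) = q.factorial := Real.Gamma_nat_eq_factorial q
  constructor
  · have h := key (q + 1 / 2) (by positivity)
    have h2 := Real.Gamma_add_one (s := (q : ℝ) + 1 / 2) (by positivity)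
    rw [show (q : ℝ) + 1 / 2 + 1 / 2 = q + 1 by ring, e1,
      show (q : ℝ) + 1 / 2 + 1 = q + 1 + 1 / 2 by ring] at h
    rw [show (q : ℝ) + 1 / 2 + 1 = q + 1 + 1 / 2 by ring] at h2
    rw [div_pow, le_div_iff₀ (by positivity)]
    calc ((q : ℝ) + 1 / 2) * (q.factorial : ℝ) ^ 2
        ≤ (q + 1 / 2) * (Real.Gamma (q + 1 / 2) * Real.Gamma (q + 1 + 1 / 2)) := by gcongr
      _ = _ := by rw [h2]; ring
  · have h := key (q + 1) (by positivity)
    rw [Real.Gamma_add_one (s := (q : ℝ) + 1) (by positivity), e1] at h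
    rw [div_pow, div_le_iff₀ (by positivity)]
    linarith

/-- Induction in steps of two: `Γ(s + 1) = s Γ(s)` raises the exponent by one. The base cases are `d
= 0`, which is exact, and `d = 1`, where `r ^ 2` is within 2 of `y`. The slack `|q - y| ≤ 1` absorbs
the parity of `N` later. -/
theorem gamma_ratio_asymptotic (d : ℕ) : ∃ C : ℝ, 0 ≤ C ∧ ∀ (q : ℕ) (y : ℝ), 1 / 2 ≤ y →
    |(q : ℝ) - y| ≤ 1 →
      |Real.Gamma (q + 1 + (d : ℝ) / 2) / (q.factorial : ℝ) - y ^ ((d : ℝ) / 2)| ≤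
        C * y ^ ((d : ℝ) / 2 - 1) := by
  induction d using Nat.twoStepInduction with
  | zero =>
    refine ⟨0, le_rfl, fun q y _ _ => ?_⟩
    have hq : (q.factorial : ℝ) ≠ 0 := by positivity
    simp [Real.Gamma_nat_eq_factorial, hq]
  | one =>
    refine ⟨2, by norm_num, fun q y hy hqy => ?_⟩
    have hy0 : 0 < y := by linarith
    obtain ⟨h1, h2⟩ := gamma_half_ratio_sq q
    rw [Nat.cast_one, Real.rpow_sub_one hy0.ne', ← Real.sqrt_eq_rpow]
    have hr : 0 < Real.Gamma (q + 1 + 1 / 2) / (q.factorial : ℝ) :=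
      div_pos (Real.Gamma_pos_of_pos (by positivity)) (by positivity)
    set r := Real.Gamma (q + 1 + 1 / 2) / (q.factorial : ℝ)
    have hs := Real.sqrt_pos.2 hy0
    have hss := Real.sq_sqrt hy0.le
    obtain ⟨h3, h4⟩ := abs_le.1 hqy
    have h5 : |r - √y| * (r + √y) ≤ 2 := by
      rw [← abs_of_pos (add_pos hr hs), ← abs_mul, abs_le]
      constructor <;> nlinarith
    rw [Real.sqrt_div_self', ← mul_div_assoc, mul_one, le_div_iff₀ hs]
    refine le_trans (mul_le_mul_of_nonneg_left (by linarith) (abs_nonneg _)) h5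
  | more d ih _ =>
    obtain ⟨C, hC, h⟩ := ih
    refine ⟨(2 + (d : ℝ) / 2) * (1 + 2 * C) + C, by positivity, fun q y hy hqy => ?_⟩
    have hy0 : 0 < y := by linarith
    have h1 := h q y hy hqy
    set δ := (d : ℝ) / 2 with hδ
    have hδ0 : 0 ≤ δ := by positivity
    rw [show ((d + 2 : ℕ) : ℝ) / 2 = δ + 1 by rw [hδ]; push_cast; ring,
      show (q : ℝ) + 1 + (δ + 1) = (q + 1 + δ) + 1 by ring, Real.Gamma_add_one (by positivity),
      Real.rpow_add_one hy0.ne', add_sub_cancel_right, mul_div_assoc]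
    set r := Real.Gamma (q + 1 + δ) / (q.factorial : ℝ)
    have hyδ := Real.rpow_pos_of_pos hy0 δ
    rw [Real.rpow_sub_one hy0.ne'] at h1
    set z := y ^ δ
    have h2 : z / y ≤ 2 * z := by
      rw [div_le_iff₀ hy0]; nlinarith
    have h3 : |r| ≤ z + C * (2 * z) := by
      calc |r| = |z + (r - z)| := by ring_nf
        _ ≤ |z| + |r - z| := abs_add_le _ _
        _ ≤ z + C * (2 * z) := by
          rw [abs_of_pos hyδ]
          have := mul_le_mul_of_nonneg_left h2 hC
          linarith
    have h4 : |(q : ℝ) + 1 + δ - y| ≤ 2 + δ := by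
      rw [abs_le] at hqy ⊢; constructor <;> linarith
    have h5 : y * |r - z| ≤ C * z := by
      calc y * |r - z| ≤ y * (C * (z / y)) := by gcongr
        _ = C * z := by field_simp
    calc |(q + 1 + δ) * r - z * y| = |(q + 1 + δ - y) * r + y * (r - z)| := by ring_nf
      _ ≤ |(q + 1 + δ - y) * r| + |y * (r - z)| := abs_add_le _ _
      _ = |(q : ℝ) + 1 + δ - y| * |r| + y * |r - z| := by rw [abs_mul, abs_mul, abs_of_pos hy0]
      _ ≤ (2 + δ) * (z + C * (2 * z)) + C * z := by gcongr
      _ = _ := by ring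

theorem moment_zero_asymptotic (d : ℕ) : ∃ C : ℝ, 0 ≤ C ∧ ∀ N : ℕ, 1 ≤ N →
    |moment d N 2 0| ≤ |moment d N 3 0| ∧
    |moment d N 3 0 - (((N : ℝ) + 1) / 2) ^ ((d : ℝ) / 2) / Real.Gamma ((d : ℝ) / 2 + 1)| ≤
      C * ((N : ℝ) + 1) ^ ((d : ℝ) / 2 - 1) := by
  obtain ⟨C, hC, h⟩ := gamma_ratio_asymptotic d
  set δ := (d : ℝ) / 2 with hδ
  have hδ0 : 0 ≤ δ := by positivity
  have hG : 0 < Real.Gamma (δ + 1) := Real.Gamma_pos_of_pos (by linarith)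
  refine ⟨C * (1 / 2) ^ (δ - 1) / Real.Gamma (δ + 1), by positivity, fun N hN => ?_⟩
  obtain ⟨N, rfl⟩ := Nat.exists_eq_add_of_le' hN
  rw [moment_two_zero, moment_three_zero]
  -- Of two consecutive coefficients of an even series the odd one vanishes. Hence their sum and
  -- their difference agree up to sign, and the sum is the coefficient of even index.
  obtain ⟨q, hq, h2, h3⟩ : ∃ q : ℕ, |(q : ℝ) - (((N + 1 : ℕ) : ℝ) + 1) / 2| ≤ 1 ∧
      |evenBinomialCoeff (δ + 1) (N + 1) - evenBinomialCoeff (δ + 1) N| ≤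
        |evenBinomialCoeff (δ + 1) (N + 1) + evenBinomialCoeff (δ + 1) N| ∧
      evenBinomialCoeff (δ + 1) (N + 1) + evenBinomialCoeff (δ + 1) N =
        evenBinomialCoeff (δ + 1) (2 * q) := by
    rcases Nat.even_or_odd' N with ⟨q, rfl | rfl⟩
    · refine ⟨q, ?_, ?_, ?_⟩
      · push_cast; rw [abs_le]; constructor <;> linarith
      · rw [evenBinomialCoeff_odd, zero_sub, zero_add, abs_neg]
      · rw [evenBinomialCoeff_odd, zero_add]
    · refine ⟨q + 1, ?_, ?_, ?_⟩
      · push_cast; rw [abs_le]; constructor <;> linarith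
      · rw [evenBinomialCoeff_odd, sub_zero, add_zero]
      · rw [evenBinomialCoeff_odd, add_zero]; rfl
  refine ⟨h2, ?_⟩
  have h4 := h q _ (by push_cast; linarith [(Nat.cast_nonneg N : (0 : ℝ) ≤ N)]) hq
  rw [h3, evenBinomialCoeff_even hδ0, ← sub_div, abs_div, abs_of_pos hG,
    div_le_iff₀ hG]
  refine h4.trans (le_of_eq ?_)
  rw [div_eq_mul_one_div (((N + 1 : ℕ) : ℝ) + 1) 2, Real.mul_rpow (by positivity) (by positivity)]
  field_simp

end GammaRatio

/-! ### Energy estimate for the density equation -/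

section DensityODE

/-- Completing squares: the terms in `ρ` cost a multiple of `R ^ 2`, and the cross term `a p q / 2`
costs `(a q) ^ 2 / 4 + p ^ 2 / 4`. The choice `κ c = 4` gives `(a + κ / n) μ ≥ 4`, so the `p ^ 2`
lost is absorbed even near `a = 0`. -/
theorem energy_coercive {D c n R κ a μ ρ p q : ℝ} (hD : 0 ≤ D) (hc : 0 < c) (hn : 1 ≤ n)
    (hκ0 : 0 < κ) (hκc : κ * c = 4) (ha : 0 ≤ a) (ha2 : a ≤ 2 * n) (hμa : c * n ≤ μ)
    (hR : |ρ| ≤ R) :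
    (a * q) ^ 2 / 4 + (a + κ / n) * μ * p ^ 2 / 4 + p ^ 2 / 2 ≤
      (a + κ / n) * (a / 2 * q ^ 2 + μ * p ^ 2 + D / 2 * ρ * p) + a / 2 * p * q -
        D / 8 * (ρ ^ 2 - p ^ 2) + (D ^ 2 / 8 * ((2 + κ) / c) + D / 8) * R ^ 2 := by
  have hn0 : 0 < n := by linarith
  have hcn := mul_pos hc hn0
  have hμ0 : 0 < μ := by linarith
  have hκn : 0 < κ / n := by positivity
  have hρa := abs_le.1 hR
  set W := a + κ / n with hW
  have hW0 : 0 < W := by linarith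
  have h1 : μ * p ^ 2 / 2 - D ^ 2 * R ^ 2 / (8 * μ) ≤ μ * p ^ 2 + D / 2 * ρ * p := by
    have e1 : 0 ≤ μ / 2 * (|p| - D * R / (2 * μ)) ^ 2 := by positivity
    have e2 : μ / 2 * (|p| - D * R / (2 * μ)) ^ 2 =
        μ * p ^ 2 / 2 - D / 2 * (R * |p|) + D ^ 2 * R ^ 2 / (8 * μ) := by
      rw [← sq_abs p]; field_simp; ring
    have e3 : -(R * |p|) ≤ ρ * p := by
      refine (neg_le_neg ?_).trans (neg_abs_le _)
      rw [abs_mul]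
      exact mul_le_mul_of_nonneg_right hR (abs_nonneg _)
    have e4 := mul_le_mul_of_nonneg_left e3 (by linarith : (0 : ℝ) ≤ D / 2)
    linarith
  have h2 : W * (D ^ 2 * R ^ 2 / (8 * μ)) ≤ D ^ 2 / 8 * ((2 + κ) / c) * R ^ 2 := by
    have e1 : W / μ ≤ (2 + κ) / c := by
      rw [div_le_div_iff₀ hμ0 hc]
      have e2 : W ≤ (2 + κ) * n := by
        have : κ / n ≤ κ * n := by
          rw [div_le_iff₀ hn0]
          calc κ ≤ κ * (1 * 1) := by linarith
            _ ≤ κ * (n * n) := by gcongr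
            _ = κ * n * n := by ring
        rw [hW]; linarith
      calc W * c ≤ (2 + κ) * n * c := by gcongr
        _ = (2 + κ) * (c * n) := by ring
        _ ≤ (2 + κ) * μ := by gcongr
    calc W * (D ^ 2 * R ^ 2 / (8 * μ)) = D ^ 2 / 8 * (W / μ) * R ^ 2 := by field_simp
      _ ≤ _ := by gcongr
  have h3 : p ^ 2 ≤ W * μ * p ^ 2 / 4 := by
    have : 4 ≤ W * μ := by
      calc (4 : ℝ) = κ / n * (c * n) := by rw [← hκc]; field_simp
        _ ≤ W * μ := mul_le_mul (by linarith) hμa hcn.le hW0.le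
    have e1 := mul_le_mul_of_nonneg_right this (sq_nonneg p)
    linarith
  have h4 : -((a * q) ^ 2 / 4) - p ^ 2 / 4 ≤ a / 2 * p * q := by
    linarith [sq_nonneg (a * q + p)]
  have h5 : ρ ^ 2 ≤ R ^ 2 := sq_le_sq' hρa.1 hρa.2
  have h6 : (a * q) ^ 2 / 2 ≤ W * (a / 2 * q ^ 2) := by
    have : a * (a / 2 * q ^ 2) ≤ W * (a / 2 * q ^ 2) :=
      mul_le_mul_of_nonneg_right (by linarith) (by positivity)
    linarith
  have h7 := mul_le_mul_of_nonneg_left h1 hW0.le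
  have h10 : 0 ≤ D / 8 * (R ^ 2 - ρ ^ 2) := mul_nonneg (by linarith) (by linarith)
  have h11 : 0 ≤ D / 8 * p ^ 2 := by positivity
  linarith [sq_nonneg p]

/-- Energy estimate for the third order equation of the density. -/
theorem density_energy_bound {D c : ℝ} (hD : 1 ≤ D) (hc : 0 < c) : ∃ K : ℝ, 0 ≤ K ∧
    ∀ (n M A R : ℝ) (ρ p q s : ℝ → ℝ), 1 ≤ n → M ≤ (D + 1) * n → 0 ≤ A → A ≤ 2 * n →
      c * n ≤ M - A / 2 → (∀ a, HasDerivAt ρ (p a) a) → (∀ a, HasDerivAt p (q a) a) →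
      (∀ a, HasDerivAt q (s a) a) →
      (∀ a, a / 2 * s a + (1 / 2 + D / 4) * q a + (M - a / 2) * p a + D / 4 * ρ a = 0) →
      (∀ a ∈ Set.Icc 0 A, |ρ a| ≤ R) → |p 0| ≤ R →
      ∀ a ∈ Set.Icc 0 A, |p a| ≤ K * R ∧ |a * q a| ≤ K * R := by
  set κ : ℝ := 4 / c with hκ
  have hκ0 : 0 < κ := by positivity
  have hκc : κ * c = 4 := by rw [hκ]; field_simp
  set C₁ : ℝ := D ^ 2 / 8 * ((2 + κ) / c) + D / 8 with hC₁
  set C₂ : ℝ := 2 * (D - 1) / c with hC₂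
  set C₃ : ℝ := κ * (D + 1) + κ * D / 2 + D / 8 with hC₃
  have hC₁0 : 0 ≤ C₁ := by positivity
  have hC₂0 : 0 ≤ C₂ := div_nonneg (by linarith) hc.le
  have hC₃0 : 0 ≤ C₃ := by positivity
  set K₀ : ℝ := (C₃ + C₁) * Real.exp (2 * C₂) with hK₀
  have hK₀0 : 0 ≤ K₀ := by positivity
  refine ⟨√(4 * K₀), Real.sqrt_nonneg _, ?_⟩
  intro n M A R ρ p q s hn hM hA hA2 hμ hρ hp hq hode hR hp0
  have hn0 : 0 < n := by linarith
  have hR0 : 0 ≤ R := (abs_nonneg _).trans hp0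
  -- The equation multiplied by `2 (a + κ / n) q + p` and integrated. Its leading coefficient
  -- vanishes at `a = 0`, so the weight must cancel nothing there: `T 0` does not contain `q 0`, and
  -- the shift `κ / n` still controls `p` near 0 while `κ / n * M` stays bounded.
  set T : ℝ → ℝ := fun a => (a + κ / n) *
    (a / 2 * q a ^ 2 + (M - a / 2) * p a ^ 2 + D / 2 * ρ a * p a) + a / 2 * p a * q a -
      D / 8 * (ρ a ^ 2 - p a ^ 2) with hT
  have hT' : ∀ a, HasDerivAt T ((D - 1) / 2 * (a + κ / n) * p a ^ 2 - (D - 1) / 2 * a * q a ^ 2 -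
      κ / n * (1 / 2 + D / 2) * q a ^ 2) a := by
    intro a
    have ha := hasDerivAt_id' a
    have h := ((((ha.add_const (κ / n)).mul ((((ha.div_const 2).mul ((hq a).pow 2)).add
      (((ha.div_const 2).const_sub M).mul ((hp a).pow 2))).add (((hρ a).const_mul (D / 2)).mul
        (hp a)))).add (((ha.div_const 2).mul (hp a)).mul (hq a)))).sub
          ((((hρ a).pow 2).sub ((hp a).pow 2)).const_mul (D / 8))
    refine h.congr_deriv ?_
    simp only [Pi.add_apply, Pi.mul_apply, Pi.pow_apply]
    push_cast
    linear_combination (2 * (a + κ / n) * q a + p a) * hode a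
  have hlow : ∀ a ∈ Set.Icc 0 A, (a * q a) ^ 2 / 4 + (a + κ / n) * (M - a / 2) * p a ^ 2 / 4 +
      p a ^ 2 / 2 ≤ T a + C₁ * R ^ 2 := by
    intro a ha
    have hcn := mul_pos hc hn0
    have hμa : c * n ≤ M - a / 2 := by linarith [ha.2]
    have h := energy_coercive (D := D) (by linarith) hc hn hκ0 hκc ha.1 (ha.2.trans hA2) hμa
      (hR a ha) (p := p a) (q := q a)
    exact h
  have hG : ∀ a ∈ Set.Icc 0 A, T a + C₁ * R ^ 2 ≤ K₀ * R ^ 2 := by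
    -- Gronwall: the only positive term of `T'` is at most `C₂ / n` times `T + C₁ R ^ 2`, and over a
    -- length `A ≤ 2 n` the growth is at most `exp (2 C₂)`, independently of `n`.
    set Φ : ℝ → ℝ := fun a => (T a + C₁ * R ^ 2) * Real.exp (-(C₂ / n) * a) with hΦ
    have hΦ' : ∀ a, HasDerivAt Φ (((D - 1) / 2 * (a + κ / n) * p a ^ 2 -
        (D - 1) / 2 * a * q a ^ 2 - κ / n * (1 / 2 + D / 2) * q a ^ 2 -
          C₂ / n * (T a + C₁ * R ^ 2)) * Real.exp (-(C₂ / n) * a)) a := by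
      intro a
      have h := ((hT' a).add_const (C₁ * R ^ 2)).mul
        (((hasDerivAt_id' a).const_mul (-(C₂ / n))).exp)
      refine h.congr_deriv ?_
      ring
    have hanti : AntitoneOn Φ (Set.Icc 0 A) := by
      refine antitoneOn_of_deriv_nonpos (convex_Icc 0 A)
        (fun a _ => (hΦ' a).continuousAt.continuousWithinAt)
        (fun a _ => (hΦ' a).differentiableAt.differentiableWithinAt) fun a ha => ?_
      rw [(hΦ' a).deriv]
      have ha' := interior_subset ha
      refine mul_nonpos_of_nonpos_of_nonneg ?_ (Real.exp_pos _).le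
      have hD1 : 0 ≤ D - 1 := by linarith
      have hWp : 0 ≤ (a + κ / n) * p a ^ 2 := by have := ha'.1; positivity
      have e1 : (D - 1) / 2 * (a + κ / n) * p a ^ 2 ≤ C₂ / n * (T a + C₁ * R ^ 2) := by
        calc (D - 1) / 2 * (a + κ / n) * p a ^ 2
            = C₂ / n * ((c * n) * ((a + κ / n) * p a ^ 2) / 4) := by
              rw [hC₂]; field_simp; ring
          _ ≤ C₂ / n * (T a + C₁ * R ^ 2) := by
              refine mul_le_mul_of_nonneg_left ?_ (by positivity)
              have e2 : (c * n) * ((a + κ / n) * p a ^ 2) ≤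
                  (M - a / 2) * ((a + κ / n) * p a ^ 2) :=
                mul_le_mul_of_nonneg_right (by linarith [ha'.2]) hWp
              linarith [hlow a ha', sq_nonneg (a * q a), sq_nonneg (p a)]
      have e3 : 0 ≤ (D - 1) / 2 * a * q a ^ 2 := by have := ha'.1; positivity
      have e4 : 0 ≤ κ / n * (1 / 2 + D / 2) * q a ^ 2 := by positivity
      linarith
    have hT0 : T 0 ≤ C₃ * R ^ 2 := by
      have hρ0 := hR 0 ⟨le_rfl, hA⟩
      have e1 : p 0 ^ 2 ≤ R ^ 2 := sq_le_sq' (abs_le.1 hp0).1 (abs_le.1 hp0).2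
      have e2 : ρ 0 * p 0 ≤ R ^ 2 := by
        refine (le_abs_self _).trans ?_
        rw [abs_mul, sq]
        exact mul_le_mul hρ0 hp0 (abs_nonneg _) hR0
      have e3 : κ / n * (M * p 0 ^ 2) ≤ κ * (D + 1) * R ^ 2 := by
        calc κ / n * (M * p 0 ^ 2) ≤ κ / n * ((D + 1) * n * R ^ 2) := by gcongr
          _ = κ * (D + 1) * R ^ 2 := by field_simp
      have e4 : κ / n * (D / 2 * (ρ 0 * p 0)) ≤ κ * D / 2 * R ^ 2 := by
        calc κ / n * (D / 2 * (ρ 0 * p 0)) ≤ κ / n * (D / 2 * R ^ 2) := by gcongr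
          _ ≤ κ / 1 * (D / 2 * R ^ 2) := by gcongr
          _ = _ := by ring
      have e5 : T 0 = κ / n * (M * p 0 ^ 2) + κ / n * (D / 2 * (ρ 0 * p 0)) -
          D / 8 * ρ 0 ^ 2 + D / 8 * p 0 ^ 2 := by
        simp only [hT]; ring
      have e6 : D / 8 * p 0 ^ 2 ≤ D / 8 * R ^ 2 := by gcongr
      have e7 : 0 ≤ D / 8 * ρ 0 ^ 2 := by positivity
      rw [e5, hC₃]
      linarith
    intro a ha
    have h1 := hanti ⟨le_rfl, hA⟩ ha ha.1
    simp only [hΦ, mul_zero, Real.exp_zero, mul_one] at h1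
    have h2 : T a + C₁ * R ^ 2 =
        (T a + C₁ * R ^ 2) * Real.exp (-(C₂ / n) * a) * Real.exp (C₂ / n * a) := by
      rw [mul_assoc, ← Real.exp_add]; simp
    have h3 : Real.exp (C₂ / n * a) ≤ Real.exp (2 * C₂) := by
      refine Real.exp_le_exp.2 ?_
      rw [div_mul_eq_mul_div, div_le_iff₀ hn0]
      linarith [mul_le_mul_of_nonneg_left (ha.2.trans hA2) hC₂0]
    rw [h2, hK₀]
    calc (T a + C₁ * R ^ 2) * Real.exp (-(C₂ / n) * a) * Real.exp (C₂ / n * a)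
        ≤ (C₃ * R ^ 2 + C₁ * R ^ 2) * Real.exp (2 * C₂) := by
          refine mul_le_mul (by linarith) h3 (Real.exp_pos _).le (by positivity)
      _ = _ := by ring
  intro a ha
  have h1 := hlow a ha
  have h2 := hG a ha
  have hW : 0 ≤ (a + κ / n) * (M - a / 2) * p a ^ 2 / 4 := by
    have h3 : 0 ≤ M - a / 2 := by linarith [ha.2, mul_pos hc hn0]
    have h4 : 0 ≤ a + κ / n := by have := ha.1; positivity
    positivity
  rw [← Real.sqrt_sq hR0, ← Real.sqrt_mul (by positivity)]
  constructor
  · refine Real.abs_le_sqrt ?_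
    linarith [sq_nonneg (a * q a), sq_nonneg (p a)]
  · refine Real.abs_le_sqrt ?_
    linarith [sq_nonneg (a * q a), sq_nonneg (p a)]

end DensityODE

/-! ### Comparison of the density with its semiclassical profile -/

section DensityODE

/-- The quotient of the density by its semiclassical value is almost constant, in terms of a bound
for the density. -/
theorem density_quotient_bound {D c : ℝ} (hD : 1 ≤ D) (hc : 0 < c) : ∃ C K : ℝ, 0 ≤ C ∧ 0 ≤ K ∧
    ∀ (n M A R : ℝ) (ρ p q s : ℝ → ℝ), 1 ≤ n → M ≤ (D + 1) * n → 0 ≤ A → A ≤ 2 * n →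
      c * n ≤ M - A / 2 → (∀ a, HasDerivAt ρ (p a) a) → (∀ a, HasDerivAt p (q a) a) →
      (∀ a, HasDerivAt q (s a) a) →
      (∀ a, a / 2 * s a + (1 / 2 + D / 4) * q a + (M - a / 2) * p a + D / 4 * ρ a = 0) →
      (∀ a ∈ Set.Icc 0 A, |ρ a| ≤ R) → |p 0| ≤ R →
      ∀ a ∈ Set.Icc 0 A, |p a| ≤ K * R ∧ |a * q a| ≤ K * R ∧
        |ρ a * (M - a / 2) ^ (-(D / 2)) - ρ 0 * M ^ (-(D / 2))| ≤ C * n ^ (-(D / 2) - 1) * R := by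
  obtain ⟨K, hK, henergy⟩ := density_energy_bound hD hc
  set δ := D / 2 with hδ
  set B := (1 / 2 + D / 4) * K with hB
  have hB0 : 0 ≤ B := by positivity
  refine ⟨((δ + 1) * c ^ (-δ - 2) + 2 * c ^ (-δ - 1)) * B, K, by positivity, hK, ?_⟩
  intro n M A R ρ p q s hn hM hA hA2 hμ hρ hp hq hode hR hp0 a ha
  have hbd := henergy n M A R ρ p q s hn hM hA hA2 hμ hρ hp hq hode hR hp0
  refine ⟨(hbd a ha).1, (hbd a ha).2, ?_⟩
  have hn0 : 0 < n := by linarith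
  have hR0 : 0 ≤ R := (abs_nonneg _).trans hp0
  have hcn := mul_pos hc hn0
  have hμa : ∀ x ∈ Set.Icc 0 A, c * n ≤ M - x / 2 := fun x hx => by linarith [hx.2]
  have hflux : ∀ x ∈ Set.Icc 0 A, |x / 2 * q x + D / 4 * p x| ≤ B * R := fun x hx => by
    obtain ⟨h1, h2⟩ := hbd x hx
    calc |x / 2 * q x + D / 4 * p x| = |1 / 2 * (x * q x) + D / 4 * p x| := by ring_nf
      _ ≤ |1 / 2 * (x * q x)| + |D / 4 * p x| := abs_add_le _ _
      _ = 1 / 2 * |x * q x| + D / 4 * |p x| := by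
        rw [abs_mul, abs_mul (D / 4), abs_of_pos (by norm_num : (0 : ℝ) < 1 / 2),
          abs_of_pos (by linarith : 0 < D / 4)]
      _ ≤ 1 / 2 * (K * R) + D / 4 * (K * R) := by gcongr
      _ = B * R := by rw [hB]; ring
  have hpow : ∀ e : ℝ, e ≤ 0 → ∀ x ∈ Set.Icc 0 A, (M - x / 2) ^ e ≤ c ^ e * n ^ e :=
    fun e he x hx => by
      rw [← Real.mul_rpow hc.le hn0.le]
      exact Real.rpow_le_rpow_of_nonpos hcn (hμa x hx) he
  -- The equation reads `(x / 2 * q + D / 4 * p)' + (M - x / 2) p + D / 4 * ρ = 0`. Multiplied by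
  -- `(M - x / 2) ^ (-δ - 1)`, its last two terms are the derivative of the quotient. Adding the
  -- weighted flux leaves a derivative of order `n ^ (-δ - 2) R`, hence a change of order `n ^ (-δ -
  -- 1) R` over a length at most `2 n`.
  set H : ℝ → ℝ := fun x => ρ x * (M - x / 2) ^ (-δ) +
    (M - x / 2) ^ (-δ - 1) * (x / 2 * q x + D / 4 * p x) with hH
  have hH' : ∀ x ∈ Set.Icc 0 A, HasDerivWithinAt H
      ((δ + 1) / 2 * (M - x / 2) ^ (-δ - 2) * (x / 2 * q x + D / 4 * p x)) (Set.Icc 0 A) x := by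
    intro x hx
    have hμ0 : 0 < M - x / 2 := hcn.trans_le (hμa x hx)
    have hm : HasDerivAt (fun x : ℝ => M - x / 2) (-(1 / 2)) x :=
      ((hasDerivAt_id' x).div_const 2).const_sub M
    have h := ((hρ x).mul (hm.rpow_const (p := -δ) (Or.inl hμ0.ne'))).add
      ((hm.rpow_const (p := -δ - 1) (Or.inl hμ0.ne')).mul
        ((((hasDerivAt_id' x).div_const 2).mul (hq x)).add ((hp x).const_mul (D / 4))))
    refine (h.congr_deriv ?_).hasDerivWithinAt
    have e1 : (M - x / 2) ^ (-δ) = (M - x / 2) * (M - x / 2) ^ (-δ - 1) := by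
      rw [Real.rpow_sub_one hμ0.ne', mul_div_cancel₀ _ hμ0.ne']
    rw [show -δ - 1 - 1 = -δ - 2 by ring, e1]
    simp only [Pi.add_apply, Pi.mul_apply]
    linear_combination (M - x / 2) ^ (-δ - 1) * hode x +
      (M - x / 2) ^ (-δ - 1) * ρ x / 2 * hδ
  have h0A : (0 : ℝ) ∈ Set.Icc 0 A := ⟨le_rfl, hA⟩
  have hδ0 : 0 < δ := by rw [hδ]; linarith
  have h1 := (convex_Icc 0 A).norm_image_sub_le_of_norm_hasDerivWithin_le
    (C := (δ + 1) / 2 * (c ^ (-δ - 2) * n ^ (-δ - 2)) * (B * R)) hH' (fun x hx => by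
      rw [Real.norm_eq_abs, abs_mul, abs_mul, abs_of_pos (by positivity : 0 < (δ + 1) / 2),
        abs_of_nonneg (Real.rpow_nonneg (hcn.le.trans (hμa x hx)) _)]
      have e1 := hpow (-δ - 2) (by linarith) x hx
      have e2 := hflux x hx
      gcongr) h0A ha
  rw [Real.norm_eq_abs, Real.norm_eq_abs, sub_zero, abs_of_nonneg ha.1] at h1
  have h2 : ∀ x ∈ Set.Icc 0 A, |(M - x / 2) ^ (-δ - 1) * (x / 2 * q x + D / 4 * p x)| ≤
      c ^ (-δ - 1) * n ^ (-δ - 1) * (B * R) := fun x hx => by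
    rw [abs_mul, abs_of_nonneg (Real.rpow_nonneg (hcn.le.trans (hμa x hx)) _)]
    exact mul_le_mul (hpow _ (by linarith) x hx) (hflux x hx) (abs_nonneg _) (by positivity)
  have h3 : (δ + 1) / 2 * (c ^ (-δ - 2) * n ^ (-δ - 2)) * (B * R) * a ≤
      (δ + 1) * c ^ (-δ - 2) * n ^ (-δ - 1) * (B * R) := by
    have e1 : n ^ (-δ - 1) = n ^ (-δ - 2) * n := by
      rw [← Real.rpow_add_one hn0.ne']; congr 1; ring
    calc (δ + 1) / 2 * (c ^ (-δ - 2) * n ^ (-δ - 2)) * (B * R) * a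
        ≤ (δ + 1) / 2 * (c ^ (-δ - 2) * n ^ (-δ - 2)) * (B * R) * (2 * n) := by
          gcongr; exact ha.2.trans hA2
      _ = _ := by rw [e1]; ring
  have h4 := h2 a ha
  have h5 := h2 0 h0A
  have h6 : ρ a * (M - a / 2) ^ (-δ) - ρ 0 * M ^ (-δ) = (H a - H 0) -
      (M - a / 2) ^ (-δ - 1) * (a / 2 * q a + D / 4 * p a) +
      (M - 0 / 2) ^ (-δ - 1) * (0 / 2 * q 0 + D / 4 * p 0) := by
    simp only [hH]
    rw [zero_div, sub_zero]
    ring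
  rw [h6]
  refine (abs_add_le _ _).trans ?_
  have h7 := abs_sub (H a - H 0) ((M - a / 2) ^ (-δ - 1) * (a / 2 * q a + D / 4 * p a))
  have h8 : ((δ + 1) * c ^ (-δ - 2) + 2 * c ^ (-δ - 1)) * B * n ^ (-δ - 1) * R =
      (δ + 1) * c ^ (-δ - 2) * n ^ (-δ - 1) * (B * R) + c ^ (-δ - 1) * n ^ (-δ - 1) * (B * R) +
      c ^ (-δ - 1) * n ^ (-δ - 1) * (B * R) := by ring
  rw [h8]
  linarith

/-- The quotient of the density by its semiclassical value is almost constant. -/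
theorem density_asymptotic {D c : ℝ} (hD : 1 ≤ D) (hc : 0 < c) : ∃ C N₀ : ℝ, 0 ≤ C ∧
    ∀ (n M A : ℝ) (ρ p q s : ℝ → ℝ), N₀ ≤ n → 1 ≤ n → n ≤ M → M ≤ (D + 1) * n → 0 ≤ A →
      A ≤ 2 * n → c * n ≤ M - A / 2 → (∀ a, HasDerivAt ρ (p a) a) →
      (∀ a, HasDerivAt p (q a) a) → (∀ a, HasDerivAt q (s a) a) →
      (∀ a, a / 2 * s a + (1 / 2 + D / 4) * q a + (M - a / 2) * p a + D / 4 * ρ a = 0) →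
      |p 0| ≤ |ρ 0| →
      |p A| ≤ C * |ρ 0| ∧ |A * q A| ≤ C * |ρ 0| ∧
        |ρ A * (M - A / 2) ^ (-(D / 2)) - ρ 0 * M ^ (-(D / 2))| ≤
          C * n ^ (-(D / 2) - 1) * |ρ 0| := by
  obtain ⟨C, K, hC, hK, hquot⟩ := density_quotient_bound hD hc
  set δ := D / 2 with hδ
  have hδ0 : 0 < δ := by rw [hδ]; linarith
  have hP : 0 < (D + 1) ^ δ := Real.rpow_pos_of_pos (by linarith) _
  set S := 2 * (D + 1) ^ δ with hS
  have hS0 : 0 ≤ S := by positivity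
  -- The bounds so far involve `R = max |ρ|`. At a maximum point the quotient estimate bounds `R` by
  -- `|ρ 0|` plus an error `C / n * R`; for `n ≥ C * S` the error is absorbed and `R ≤ S * |ρ 0|`.
  refine ⟨(C + K) * S, C * S, by positivity, ?_⟩
  intro n M A ρ p q s hN hn hnM hM hA hA2 hμ hρ hp hq hode hp0
  have hn0 : 0 < n := by linarith
  have hcn := mul_pos hc hn0
  obtain ⟨x, hx, hmax⟩ := isCompact_Icc.exists_isMaxOn (Set.nonempty_Icc.2 hA)
    (f := fun a => |ρ a|) fun a _ => (hρ a).continuousAt.abs.continuousWithinAt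
  have h0A : (0 : ℝ) ∈ Set.Icc 0 A := ⟨le_rfl, hA⟩
  have hmax' : ∀ a ∈ Set.Icc 0 A, |ρ a| ≤ |ρ x| := fun a ha => hmax ha
  have hbd := hquot n M A |ρ x| ρ p q s hn hM hA hA2 hμ hρ hp hq hode hmax'
    (hp0.trans (hmax' 0 h0A))
  have hRS : |ρ x| ≤ S * |ρ 0| := by
    have h1 := (hbd x hx).2.2
    have hμ0 : 0 < M - x / 2 := by linarith [hx.2]
    have hM0 : 0 < M := by linarith
    have h2 : |ρ x| * (M - x / 2) ^ (-δ) ≤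
        |ρ 0| * M ^ (-δ) + C * n ^ (-δ - 1) * |ρ x| := by
      have e1 := abs_sub_abs_le_abs_sub (ρ x * (M - x / 2) ^ (-δ)) (ρ 0 * M ^ (-δ))
      rw [abs_mul, abs_mul, abs_of_pos (Real.rpow_pos_of_pos hμ0 _),
        abs_of_pos (Real.rpow_pos_of_pos hM0 _)] at e1
      linarith
    have h3 : ((D + 1) * n) ^ (-δ) ≤ (M - x / 2) ^ (-δ) :=
      Real.rpow_le_rpow_of_nonpos hμ0 (by linarith [hx.1]) (by linarith)
    have h4 : M ^ (-δ) ≤ n ^ (-δ) := Real.rpow_le_rpow_of_nonpos hn0 hnM (by linarith)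
    rw [Real.mul_rpow (by linarith) hn0.le] at h3
    have h5 : |ρ x| * ((D + 1) ^ (-δ) * n ^ (-δ)) ≤
        |ρ 0| * n ^ (-δ) + C * (n ^ (-δ) / n) * |ρ x| := by
      rw [← Real.rpow_sub_one hn0.ne']
      have e1 := mul_le_mul_of_nonneg_left h3 (abs_nonneg (ρ x))
      have e2 := mul_le_mul_of_nonneg_left h4 (abs_nonneg (ρ 0))
      linarith
    have hnδ := Real.rpow_pos_of_pos hn0 (-δ)
    rw [Real.rpow_neg (by linarith : 0 ≤ D + 1)] at h5
    set z := n ^ (-δ)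
    have h6 : C / n ≤ 1 / (2 * (D + 1) ^ δ) := by
      rw [div_le_div_iff₀ hn0 (by positivity)]; linarith
    have h7 : |ρ x| * ((D + 1) ^ δ)⁻¹ ≤ |ρ 0| + C / n * |ρ x| := by
      refine le_of_mul_le_mul_right ?_ hnδ
      calc |ρ x| * ((D + 1) ^ δ)⁻¹ * z = |ρ x| * (((D + 1) ^ δ)⁻¹ * z) := by ring
        _ ≤ |ρ 0| * z + C * (z / n) * |ρ x| := h5
        _ = _ := by ring
    have h8 := mul_le_mul_of_nonneg_right h6 (abs_nonneg (ρ x))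
    have h9 : |ρ x| * (1 / (2 * (D + 1) ^ δ)) ≤ |ρ 0| := by
      have e1 : |ρ x| * ((D + 1) ^ δ)⁻¹ = 2 * (|ρ x| * (1 / (2 * (D + 1) ^ δ))) := by
        field_simp
      linarith
    rw [mul_one_div, div_le_iff₀ (by positivity)] at h9
    rw [hS]; linarith
  obtain ⟨h1, h2, h3⟩ := hbd A ⟨hA, le_rfl⟩
  have e1 : K * |ρ x| ≤ (C + K) * S * |ρ 0| := by
    calc K * |ρ x| ≤ K * (S * |ρ 0|) := by gcongr
      _ = K * S * |ρ 0| := by ring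
      _ ≤ (C + K) * S * |ρ 0| := by gcongr; linarith
  refine ⟨h1.trans e1, h2.trans e1, h3.trans ?_⟩
  calc C * n ^ (-δ - 1) * |ρ x| ≤ C * n ^ (-δ - 1) * (S * |ρ 0|) := by gcongr
    _ = C * S * n ^ (-δ - 1) * |ρ 0| := by ring
    _ ≤ (C + K) * S * n ^ (-δ - 1) * |ρ 0| := by gcongr; linarith

end DensityODE

/-! ### Asymptotics of the density -/

section MomentAsymptotics

theorem rpow_lipschitz {c₁ c₂ δ : ℝ} (hc : 0 < c₁) : ∃ C : ℝ, 0 ≤ C ∧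
    ∀ x ∈ Set.Icc c₁ c₂, ∀ y ∈ Set.Icc c₁ c₂, |x ^ δ - y ^ δ| ≤ C * |x - y| := by
  have hcont : ContinuousOn (fun x : ℝ => δ * x ^ (δ - 1)) (Set.Icc c₁ c₂) := fun x hx =>
    ((Real.continuousAt_rpow_const x _ (Or.inl (hc.trans_le hx.1).ne')).const_mul δ
      ).continuousWithinAt
  obtain ⟨C, hC⟩ := isCompact_Icc.exists_bound_of_continuousOn hcont
  refine ⟨|C|, abs_nonneg _, fun x hx y hy => ?_⟩
  exact (convex_Icc c₁ c₂).norm_image_sub_le_of_norm_hasDerivWithin_le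
    (f := fun x : ℝ => x ^ δ) (f' := fun x => δ * x ^ (δ - 1))
    (fun z hz => (Real.hasDerivAt_rpow_const
      (Or.inl (hc.trans_le hz.1).ne')).hasDerivWithinAt)
    (fun z hz => (hC z hz).trans (le_abs_self C)) hy hx

/-- Asymptotics of the density and bounds of its first two derivatives. -/
theorem moment_three_asymptotic {d : ℕ} (hd : 1 ≤ d) {l E : ℝ} (hl : 0 < l) (hl1 : l ≤ 1)
    (hE : 0 ≤ E) : ∃ C N₀ : ℝ, 0 ≤ C ∧ ∀ (N : ℕ) (n A : ℝ), n = N + 1 → N₀ ≤ n → 0 ≤ A →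
      A ≤ 2 * n → |n - A / 2 - n * l| ≤ E →
      |moment d N 2 A| ≤ C * n ^ ((d : ℝ) / 2) ∧ |A * moment d N 1 A| ≤ C * n ^ ((d : ℝ) / 2) ∧
      |moment d N 3 A - (n * l / 2) ^ ((d : ℝ) / 2) / Real.Gamma ((d : ℝ) / 2 + 1)| ≤
        C * n ^ ((d : ℝ) / 2 - 1) := by
  have hD : (1 : ℝ) ≤ d := by exact_mod_cast hd
  set D : ℝ := (d : ℝ) with hDd
  set c : ℝ := l / 2 with hc
  have hc0 : 0 < c := by positivity
  obtain ⟨C₁, N₁, hC₁, hdens⟩ := density_asymptotic hD hc0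
  obtain ⟨C₂, hC₂, hzero⟩ := moment_zero_asymptotic d
  set δ : ℝ := D / 2 with hδ
  have hδ0 : 0 < δ := by rw [hδ]; linarith
  -- Both `μ / M` and `l` lie in this interval, since `μ ≥ c n` and `M ≤ (D + 1) n`.
  obtain ⟨C₃, hC₃, hlip⟩ := rpow_lipschitz (c₁ := c / (D + 1)) (c₂ := 1) (δ := δ) (by positivity)
  set G := Real.Gamma (δ + 1) with hG
  have hG0 : 0 < G := Real.Gamma_pos_of_pos (by linarith)
  set g : ℝ := (1 / 2) ^ δ / G with hg
  have hg0 : 0 < g := by positivity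
  set C₄ := g + C₂ with hC₄
  set C₅ := (D + 1) ^ δ * (C₁ * C₄) + C₂ + g * (C₃ * (E + 2 * D)) with hC₅
  have hC₅0 : 0 ≤ C₅ := by positivity
  -- `n ≥ 2` gives `N ≥ 1`; `n ≥ 2 E / l` gives `E ≤ c n` and thus `M - A / 2 ≥ c n`, which keeps
  -- the argument in the bulk.
  refine ⟨C₁ * C₄ + C₅, max N₁ (max 2 (2 * E / l)), by positivity, ?_⟩
  intro N n A hn hN hA hA2 hl2
  have hN1 : N₁ ≤ n := (le_max_left _ _).trans hN
  have hN2 : 2 ≤ n := ((le_max_left _ _).trans (le_max_right _ _)).trans hN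
  have hN3 : 2 * E / l ≤ n := ((le_max_right _ _).trans (le_max_right _ _)).trans hN
  have hn0 : 0 < n := by linarith
  have hNN : 1 ≤ N := by
    have : (1 : ℝ) ≤ N := by linarith
    exact_mod_cast this
  obtain ⟨hz1, hz2⟩ := hzero N hNN
  rw [← hn, div_eq_mul_one_div n 2, Real.mul_rpow hn0.le (by norm_num), mul_div_assoc, ← hg] at hz2
  set M : ℝ := N + 1 / 2 + D / 2 with hM
  have hMn : M = n + (D - 1) / 2 := by rw [hM, hn]; ring
  have hM1 : n ≤ M := by rw [hMn]; linarith
  have hM2 : M ≤ (D + 1) * n := by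
    rw [hMn]; linarith [mul_le_mul_of_nonneg_left (by linarith : 1 ≤ n) (by linarith : 0 ≤ D)]
  have hM0 : 0 < M := by linarith
  have hEl : E ≤ c * n := by
    rw [div_le_iff₀ hl] at hN3
    rw [hc]; linarith
  have hcM : c * n ≤ M - A / 2 := by
    have := (abs_le.1 hl2).1
    have e : n * l = c * n + c * n := by rw [hc]; ring
    linarith
  have hr0 : |moment d N 3 0| ≤ C₄ * n ^ δ := by
    have e1 : n ^ (δ - 1) ≤ n ^ δ :=
      Real.rpow_le_rpow_of_exponent_le (by linarith) (by linarith)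
    calc |moment d N 3 0| = |n ^ δ * g + (moment d N 3 0 - n ^ δ * g)| := by ring_nf
      _ ≤ |n ^ δ * g| + |moment d N 3 0 - n ^ δ * g| := abs_add_le _ _
      _ ≤ n ^ δ * g + C₂ * n ^ (δ - 1) := by
        rw [abs_of_pos (mul_pos (Real.rpow_pos_of_pos hn0 _) hg0)]
        linarith
      _ ≤ n ^ δ * g + C₂ * n ^ δ := by gcongr
      _ = C₄ * n ^ δ := by rw [hC₄]; ring
  obtain ⟨h1, h2, h3⟩ := hdens n M A (moment d N 3) (fun a => -moment d N 2 a) (moment d N 1)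
    (fun a => -moment d N 0 a) hN1 (by linarith) hM1 hM2 hA hA2 hcM
    (fun a => hasDerivAt_moment d N 2 a)
    (fun a => ((hasDerivAt_moment d N 1 a).neg).congr_deriv (neg_neg _))
    (fun a => hasDerivAt_moment d N 0 a)
    (fun a => by
      have := moment_recurrence d N 0 a
      push_cast at this
      rw [hM, hDd]
      linear_combination this)
    (by rw [abs_neg]; exact hz1)
  rw [abs_neg] at h1
  have hnδ := Real.rpow_pos_of_pos hn0 δ
  have hCC : C₁ * |moment d N 3 0| ≤ (C₁ * C₄ + C₅) * n ^ δ := by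
    calc C₁ * |moment d N 3 0| ≤ C₁ * (C₄ * n ^ δ) := by gcongr
      _ = C₁ * C₄ * n ^ δ := by ring
      _ ≤ (C₁ * C₄ + C₅) * n ^ δ := by gcongr; linarith
  refine ⟨h1.trans hCC, h2.trans hCC, ?_⟩
  set μ := M - A / 2 with hμ
  have hcn : 0 < c * n := by positivity
  have hμ0 : 0 < μ := by linarith
  have hμM : μ ≤ M := by linarith
  have hμδ := Real.rpow_pos_of_pos hμ0 δ
  have hMδ := Real.rpow_pos_of_pos hM0 δ
  set r := moment d N 3 A with hr
  set r₀ := moment d N 3 0 with hr₀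
  -- Three errors are added: transport of the density from 0 to `A`, the initial value (`hb`), and
  -- the replacement of `μ / M` by `l` (`hcc`).
  have ha : |r - (μ / M) ^ δ * r₀| ≤ (D + 1) ^ δ * (C₁ * C₄) * n ^ (δ - 1) := by
    have e1 : r - (μ / M) ^ δ * r₀ = μ ^ δ * (r * μ ^ (-δ) - r₀ * M ^ (-δ)) := by
      rw [Real.div_rpow hμ0.le hM0.le, Real.rpow_neg hμ0.le, Real.rpow_neg hM0.le]
      field_simp
    have e2 : μ ^ δ ≤ (D + 1) ^ δ * n ^ δ := by
      rw [← Real.mul_rpow (by linarith) hn0.le]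
      exact Real.rpow_le_rpow hμ0.le (by linarith) hδ0.le
    rw [e1, abs_mul, abs_of_pos hμδ]
    calc μ ^ δ * |r * μ ^ (-δ) - r₀ * M ^ (-δ)|
        ≤ ((D + 1) ^ δ * n ^ δ) * (C₁ * n ^ (-δ - 1) * (C₄ * n ^ δ)) := by
          refine mul_le_mul e2 (h3.trans ?_) (abs_nonneg _) (by positivity)
          gcongr
      _ = (D + 1) ^ δ * (C₁ * C₄) * (n ^ δ * n ^ δ * n ^ (-δ - 1)) := by ring
      _ = _ := by
        rw [← Real.rpow_add hn0, ← Real.rpow_add hn0]; congr 2; ring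
  have hμM1 : μ / M ≤ 1 := (div_le_one hM0).2 hμM
  have hb : |(μ / M) ^ δ * r₀ - (μ / M) ^ δ * (n ^ δ * g)| ≤ C₂ * n ^ (δ - 1) := by
    rw [← mul_sub, abs_mul, abs_of_nonneg (by positivity)]
    calc (μ / M) ^ δ * |r₀ - n ^ δ * g| ≤ 1 * (C₂ * n ^ (δ - 1)) := by
          refine mul_le_mul (Real.rpow_le_one (by positivity) hμM1 hδ0.le) hz2 (abs_nonneg _)
            zero_le_one
      _ = _ := one_mul _
  have hlow : c / (D + 1) ≤ μ / M := by
    rw [div_le_div_iff₀ (by linarith) hM0]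
    calc c * M ≤ c * ((D + 1) * n) := by gcongr
      _ = (c * n) * (D + 1) := by ring
      _ ≤ μ * (D + 1) := by gcongr
  have hll : c / (D + 1) ≤ l := by
    rw [div_le_iff₀ (by linarith), hc]
    linarith [mul_le_mul_of_nonneg_left (by linarith : 1 ≤ D) hl.le]
  have hdiff : |μ / M - l| ≤ (E + 2 * D) / n := by
    have e1 : μ / M - l = (μ - l * M) / M := by field_simp
    rw [e1, abs_div, abs_of_pos hM0]
    have e2 : |μ - l * M| ≤ E + 2 * D := by
      have e3 : μ - l * M = (n - A / 2 - n * l) + (1 - l) * ((D - 1) / 2) := by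
        rw [hμ, hMn]; ring
      rw [e3]
      have e4 : |(1 - l) * ((D - 1) / 2)| ≤ 2 * D := by
        rw [abs_of_nonneg (mul_nonneg (by linarith) (by linarith))]
        calc (1 - l) * ((D - 1) / 2) ≤ 1 * (2 * D) := by
              refine mul_le_mul (by linarith) (by linarith) (by linarith) zero_le_one
          _ = _ := one_mul _
      linarith [abs_add_le (n - A / 2 - n * l) ((1 - l) * ((D - 1) / 2))]
    gcongr
  have hcc : |(μ / M) ^ δ * (n ^ δ * g) - l ^ δ * (n ^ δ * g)| ≤
      g * (C₃ * (E + 2 * D)) * n ^ (δ - 1) := by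
    rw [← sub_mul, abs_mul, abs_of_pos (mul_pos hnδ hg0)]
    calc |(μ / M) ^ δ - l ^ δ| * (n ^ δ * g)
        ≤ (C₃ * ((E + 2 * D) / n)) * (n ^ δ * g) := by
          refine mul_le_mul_of_nonneg_right ?_ (by positivity)
          refine (hlip _ ⟨hlow, hμM1⟩ _ ⟨hll, hl1⟩).trans ?_
          gcongr
      _ = _ := by rw [Real.rpow_sub_one hn0.ne']; ring
  have hmain : (n * l / 2) ^ δ / G = l ^ δ * (n ^ δ * g) := by
    rw [hg, show n * l / 2 = l * (n * (1 / 2)) by ring, Real.mul_rpow hl.le (by positivity),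
      Real.mul_rpow hn0.le (by norm_num)]
    ring
  rw [hmain]
  have e1 : r - l ^ δ * (n ^ δ * g) = (r - (μ / M) ^ δ * r₀) +
      ((μ / M) ^ δ * r₀ - (μ / M) ^ δ * (n ^ δ * g)) +
      ((μ / M) ^ δ * (n ^ δ * g) - l ^ δ * (n ^ δ * g)) := by ring
  rw [e1]
  refine (abs_add_le _ _).trans ((add_le_add (abs_add_le _ _) le_rfl).trans ?_)
  have e2 : C₅ * n ^ (δ - 1) ≤ (C₁ * C₄ + C₅) * n ^ (δ - 1) := by
    gcongr
    linarith [mul_nonneg hC₁ (by positivity : 0 ≤ C₄)]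
  refine le_trans ?_ e2
  rw [hC₅, add_mul, add_mul]
  linarith

end MomentAsymptotics

/-! ### Asymptotics of all moments and the series of the sine kernel -/

section MomentAsymptotics

/-- Asymptotics of all moments, with an error of relative order `1 / n`. -/
theorem moment_asymptotic {d : ℕ} (hd : 1 ≤ d) {l E : ℝ} (hl : 0 < l) (hl1 : l ≤ 1)
    (hE : 0 ≤ E) : ∃ L B N₀ : ℝ, 0 ≤ L ∧ 0 ≤ B ∧ ∀ (N : ℕ) (n A : ℝ), n = N + 1 → N₀ ≤ n →
      0 ≤ A → A ≤ 2 * n → |n - A / 2 - n * l| ≤ E → ∀ k : ℕ,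
      |moment d N (k + 3) A - (n * l / 2) ^ ((d : ℝ) / 2) * (2 * n * l) ^ k /
        Real.Gamma (k + (d : ℝ) / 2 + 1)| ≤ L * (B * n) ^ k * n ^ ((d : ℝ) / 2 - 1) := by
  obtain ⟨C, N₀, hC, hbase⟩ := moment_three_asymptotic hd hl hl1 hE
  have hD : (1 : ℝ) ≤ d := by exact_mod_cast hd
  set D : ℝ := (d : ℝ) with hDd
  set δ : ℝ := D / 2 with hδ
  have hδ0 : 0 < δ := by rw [hδ]; linarith
  have hG0 : 0 < Real.Gamma (δ + 1) := Real.Gamma_pos_of_pos (by linarith)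
  set L := C + 1 / Real.Gamma (δ + 1) with hL
  set B := 2 * E + 2 * D + 4 with hB
  have hL0 : 0 ≤ L := by positivity
  have hB0 : 0 ≤ B := by positivity
  refine ⟨L, B, N₀, hL0, hB0, ?_⟩
  intro N n A hn hN hA hA2 hE2
  obtain ⟨hb1, hb2, hb3⟩ := hbase N n A hn hN hA hA2 hE2
  have hn1 : 1 ≤ n := by rw [hn]; linarith [(Nat.cast_nonneg N : (0 : ℝ) ≤ N)]
  have hn0 : 0 < n := by linarith
  have hnδ := Real.rpow_pos_of_pos hn0 δ
  set m : ℕ → ℝ := fun k => (n * l / 2) ^ δ * (2 * n * l) ^ k / Real.Gamma (k + δ + 1) with hm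
  have hmrec : ∀ k : ℕ, (((k : ℝ) + 1) / 2 + D / 4) * m (k + 1) = n * l * m k := fun k => by
    have hGk : Real.Gamma ((k : ℝ) + δ + 1) ≠ 0 := (Real.Gamma_pos_of_pos (by positivity)).ne'
    have hk : (k : ℝ) + δ + 1 ≠ 0 := by positivity
    simp only [hm]
    rw [show ((k + 1 : ℕ) : ℝ) + δ + 1 = (k + δ + 1) + 1 by push_cast; ring,
      Real.Gamma_add_one hk, show ((k : ℝ) + 1) / 2 + D / 4 = (k + δ + 1) / 2 by rw [hδ]; ring]
    generalize Real.Gamma ((k : ℝ) + δ + 1) = G at hGk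
    field_simp
    ring
  -- The recurrence has four terms, so the induction carries size bounds for three consecutive
  -- moments besides the error. The lowest one is weighted by `A`, as in the recurrence, because
  -- only `A * moment d N 1 A` is controlled at the start.
  have key : ∀ k : ℕ,
      n * |moment d N (k + 3) A - m k| ≤ L * (B * n) ^ k * n ^ δ ∧
      |moment d N (k + 3) A| ≤ L * (B * n) ^ k * n ^ δ ∧
      |moment d N (k + 2) A| ≤ L * (B * n) ^ k * n ^ δ ∧
      |A * moment d N (k + 1) A| ≤ L * (B * n) ^ k * n ^ δ := by
    intro k
    induction k with
    | zero =>
      have hCL : C * n ^ δ ≤ L * n ^ δ := by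
        gcongr; rw [hL]; linarith [one_div_pos.2 hG0]
      have e0 : m 0 = (n * l / 2) ^ δ / Real.Gamma (δ + 1) := by simp [hm]
      have e1 : n * |moment d N 3 A - m 0| ≤ C * n ^ δ := by
        rw [e0]
        calc _ ≤ n * (C * n ^ (δ - 1)) := by gcongr
          _ = C * n ^ δ := by rw [Real.rpow_sub_one hn0.ne']; field_simp
      have e2 : |m 0| ≤ 1 / Real.Gamma (δ + 1) * n ^ δ := by
        rw [e0, abs_of_nonneg (by positivity), one_div_mul_eq_div]
        gcongr
        linarith [mul_le_mul_of_nonneg_left hl1 hn0.le]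
      have e3 : |moment d N 3 A - m 0| ≤ C * n ^ δ :=
        le_trans (le_mul_of_one_le_left (abs_nonneg _) hn1) e1
      simp only [zero_add, pow_zero, mul_one]
      refine ⟨e1.trans hCL, ?_, hb1.trans hCL, hb2.trans hCL⟩
      calc |moment d N 3 A| = |(moment d N 3 A - m 0) + m 0| := by ring_nf
        _ ≤ |moment d N 3 A - m 0| + |m 0| := abs_add_le _ _
        _ ≤ L * n ^ δ := by rw [hL, add_mul]; linarith
    | succ k ih =>
      obtain ⟨h1, h2, h3, h4⟩ := ih
      set Z := L * (B * n) ^ k * n ^ δ with hZ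
      have hZ0 : 0 ≤ Z := by positivity
      have hZ' : L * (B * n) ^ (k + 1) * n ^ δ = B * n * Z := by rw [hZ]; ring
      rw [hZ']
      have hrec := moment_recurrence d N (k + 1) A
      rw [← hDd] at hrec
      push_cast at hrec
      rw [show k + 1 + 2 = k + 3 by ring, show k + 1 + 1 = k + 2 by ring,
        add_sub_cancel_right] at hrec
      rw [show k + 1 + 2 = k + 3 by ring, show k + 1 + 1 = k + 2 by ring]
      have hk0 : (0 : ℝ) ≤ k := Nat.cast_nonneg k
      set w := ((k : ℝ) + 1) / 2 + D / 4 with hw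
      have hw0 : 1 / 2 ≤ w := by rw [hw]; linarith
      set x := moment d N (k + 1 + 3) A
      set F := moment d N (k + 3) A
      set F₁ := moment d N (k + 2) A
      set F₂ := moment d N (k + 1) A
      have hM : |n - A / 2 - n * l + (D - 1) / 2| ≤ E + D := by
        refine (abs_add_le _ _).trans (add_le_add hE2 ?_)
        rw [abs_of_nonneg (by linarith)]; linarith
      -- The coefficient growing with `k` is dominated by the one on the left side; after division
      -- by `w` each step costs a factor at most `B n`, with `B` independent of `k`.
      have hr : |(k : ℝ) / 2 - D / 4| ≤ w := by
        rw [abs_le]; constructor <;> rw [hw] <;> linarith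
      have hrest : |((k : ℝ) / 2 - D / 4) * F₁ + A / 2 * F₂| ≤ w * Z + Z / 2 := by
        refine (abs_add_le _ _).trans (add_le_add ?_ ?_)
        · rw [abs_mul]; exact mul_le_mul hr h3 (abs_nonneg _) (by linarith)
        · rw [show A / 2 * F₂ = 1 / 2 * (A * F₂) by ring, abs_mul,
            abs_of_pos (by norm_num : (0 : ℝ) < 1 / 2)]
          linarith
      have hMF : |(n - A / 2 - n * l + (D - 1) / 2) * F| ≤ (E + D) * Z := by
        rw [abs_mul]; exact mul_le_mul hM h2 (abs_nonneg _) (by linarith)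
      have hwZ : 1 / 2 * Z ≤ w * Z := mul_le_mul_of_nonneg_right hw0 hZ0
      have hEZ : 0 ≤ (E + D) * Z := by positivity
      have hnZ : Z ≤ n * Z := le_mul_of_one_le_left hZ0 hn1
      have hwE : (E + D) * Z ≤ w * (2 * (E + D) * Z) := by
        calc (E + D) * Z = 1 / 2 * (2 * (E + D) * Z) := by ring
          _ ≤ w * (2 * (E + D) * Z) := by gcongr
      have e1 : w * (x - m (k + 1)) = n * l * (F - m k) +
          (n - A / 2 - n * l + (D - 1) / 2) * F +
          (((k : ℝ) / 2 - D / 4) * F₁ + A / 2 * F₂) := by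
        have := hmrec k
        rw [← hw] at this
        rw [mul_sub, this, hrec, hn]
        ring
      have e2 : |x - m (k + 1)| ≤ B * Z := by
        have f1 : |n * l * (F - m k)| ≤ Z := by
          rw [abs_mul, abs_of_pos (mul_pos hn0 hl)]
          calc n * l * |F - m k| ≤ n * 1 * |F - m k| := by gcongr
            _ ≤ Z := by rw [mul_one]; exact h1
        have f2 : w * |x - m (k + 1)| ≤ Z + (E + D) * Z + (w * Z + Z / 2) := by
          rw [← abs_of_nonneg (by linarith : 0 ≤ w), ← abs_mul, abs_of_nonneg
            (by linarith : 0 ≤ w), e1]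
          refine (abs_add_le _ _).trans (add_le_add ((abs_add_le _ _).trans ?_) hrest)
          exact add_le_add f1 hMF
        refine le_of_mul_le_mul_left (f2.trans ?_) (by linarith : 0 < w)
        have f3 : w * (B * Z) = w * (2 * (E + D) * Z) + 4 * (w * Z) := by rw [hB]; ring
        rw [f3]
        linarith
      refine ⟨?_, ?_, ?_, ?_⟩
      · calc n * |x - m (k + 1)| ≤ n * (B * Z) := by gcongr
          _ = B * n * Z := by ring
      · have f2 : w * |x| ≤ n * Z + (E + D) * Z + (w * Z + Z / 2) := by
          have f1 : w * x = n * l * F + (n - A / 2 - n * l + (D - 1) / 2) * F +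
              (((k : ℝ) / 2 - D / 4) * F₁ + A / 2 * F₂) := by
            rw [hrec, hn]; ring
          rw [← abs_of_nonneg (by linarith : 0 ≤ w), ← abs_mul, abs_of_nonneg
            (by linarith : 0 ≤ w), f1]
          refine (abs_add_le _ _).trans (add_le_add ((abs_add_le _ _).trans ?_) hrest)
          refine add_le_add ?_ hMF
          rw [abs_mul, abs_of_pos (mul_pos hn0 hl)]
          calc n * l * |F| ≤ n * 1 * Z := by gcongr
            _ = n * Z := by rw [mul_one]
        refine le_of_mul_le_mul_left (f2.trans ?_) (by linarith : 0 < w)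
        have f3 : w * (B * n * Z) = n * (w * (2 * (E + D) * Z)) + 4 * (n * (w * Z)) := by
          rw [hB]; ring
        have f4 : w * (2 * (E + D) * Z) ≤ n * (w * (2 * (E + D) * Z)) :=
          le_mul_of_one_le_left (by positivity) hn1
        have f5 : w * Z ≤ n * (w * Z) := le_mul_of_one_le_left (by positivity) hn1
        have f6 : n * (1 / 2 * Z) ≤ n * (w * Z) := by gcongr
        rw [f3]
        linarith
      · refine h2.trans (le_mul_of_one_le_left hZ0 ?_)
        exact one_le_mul_of_one_le_of_one_le (by rw [hB]; linarith) hn1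
      · rw [abs_mul, abs_of_nonneg hA]
        calc A * |F₁| ≤ 2 * n * Z := by gcongr
          _ ≤ B * n * Z := by gcongr; rw [hB]; linarith
  intro k
  have h := (key k).1
  rw [Real.rpow_sub_one hn0.ne', ← mul_div_assoc, le_div_iff₀ hn0, mul_comm _ n]
  exact h

theorem hasSum_sineKernel (d : ℕ) {r : ℝ} (hr : 0 ≤ r) :
    HasSum (fun k : ℕ => (1 / √Real.pi) ^ d *
      ((-(r ^ 2)) ^ k / (k.factorial : ℝ) / Real.Gamma (k + (d : ℝ) / 2 + 1)))
      (sineKernel d r) := by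
  have hpi : (1 / √Real.pi) ^ d = 1 / Real.pi ^ ((d : ℝ) / 2) := by
    rw [one_div_pow, Real.sqrt_eq_rpow, ← Real.rpow_natCast, ← Real.rpow_mul Real.pi_pos.le]
    congr 2; ring
  have hpd : 0 < Real.pi ^ ((d : ℝ) / 2) := Real.rpow_pos_of_pos Real.pi_pos _
  rw [sineKernel, hpi]
  split_ifs with h
  · subst h
    convert hasSum_single (0 : ℕ) _ using 1
    · simp
      ring
    · intro k hk
      simp [hk]
  · have hr0 : 0 < r := lt_of_le_of_ne hr (Ne.symm h)
    have hra := Real.rpow_pos_of_pos hr0 ((d : ℝ) / 2)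
    have hs := ((summable_besselJ ((d : ℝ) / 2) (by positivity) r hr0).hasSum).div_const
      ((Real.pi * r) ^ ((d : ℝ) / 2))
    refine hs.congr_fun fun k => ?_
    rw [besselTerm_eq _ _ _ hr0, Real.mul_rpow Real.pi_pos.le hr, neg_pow (r ^ 2), ← pow_mul]
    field_simp

end MomentAsymptotics

/-! ### Bulk scaling and conclusion -/

theorem bulkNu_eq {d : ℕ} {X : EuclideanSpace ℝ (Fin d)} (hX : ‖X‖ < √2) :
    bulkNu X = ((1 - ‖X‖ ^ 2 / 2) / 2) ^ ((d : ℝ) / 2) := by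
  have hX2 : ‖X‖ ^ 2 < 2 := by
    rw [← Real.sq_sqrt (zero_le_two (α := ℝ))]
    exact pow_lt_pow_left₀ hX (norm_nonneg _) two_ne_zero
  have h4 : (2 : ℝ) ^ (-(d : ℝ)) = (1 / 4) ^ ((d : ℝ) / 2) := by
    rw [show (1 / 4 : ℝ) = 2 ^ (-2 : ℝ) by
      rw [Real.rpow_neg (by norm_num)]; norm_num, ← Real.rpow_mul (by norm_num)]
    congr 1; ring
  rw [bulkNu, h4, ← Real.mul_rpow (by norm_num) (by linarith)]
  congr 1; ring

theorem bulkNu_rpow_inv {d : ℕ} (hd : 1 ≤ d) {X : EuclideanSpace ℝ (Fin d)} (hX : ‖X‖ < √2) :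
    bulkNu X ^ (1 / (d : ℝ)) = √((1 - ‖X‖ ^ 2 / 2) / 2) := by
  have hX2 : ‖X‖ ^ 2 < 2 := by
    rw [← Real.sq_sqrt (zero_le_two (α := ℝ))]
    exact pow_lt_pow_left₀ hX (norm_nonneg _) two_ne_zero
  have hd0 : (d : ℝ) ≠ 0 := by positivity
  rw [bulkNu_eq hX, ← Real.rpow_mul (by linarith), Real.sqrt_eq_rpow]
  congr 1; field_simp

/-- Convergence of the rescaled kernel to the sine kernel, in terms of the norms of `x + y` and
`x - y` only. -/
theorem scaledFermiKernel_sub_sineKernel_le {d : ℕ} (hd : 1 ≤ d) {l E R : ℝ} (hl : 0 < l)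
    (hl1 : l ≤ 1) (hE : 0 ≤ E) : ∃ C N₀ : ℝ, ∀ (N : ℕ) (n r : ℝ)
      (x y : EuclideanSpace ℝ (Fin d)), n = N + 1 → N₀ ≤ n → 0 ≤ r → r ≤ R →
      |n - ‖x + y‖ ^ 2 / 4 / 2 - n * l| ≤ E → ‖x - y‖ ^ 2 / 4 = r ^ 2 / (2 * l * n) →
      |1 / ((l / 2) ^ ((d : ℝ) / 2) * n ^ d) * (n ^ ((d : ℝ) / 2) * fermiKernel (N + 1) x y) -
        sineKernel d r| ≤ C / n := by
  obtain ⟨L, B, N₀, hL, hB, hmom⟩ := moment_asymptotic hd hl hl1 hE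
  set δ : ℝ := (d : ℝ) / 2 with hδ
  have hl2 : 0 < (l / 2) ^ δ := Real.rpow_pos_of_pos (by positivity) _
  set P : ℝ := (1 / √Real.pi) ^ d with hP
  have hP0 : 0 ≤ P := by positivity
  -- The exponential is the sum of the termwise errors: `b ^ k / k!` has `n ^ k` in the denominator,
  -- which cancels the `n ^ k` in the moment bound.
  refine ⟨P * (L / (l / 2) ^ δ) * Real.exp (R ^ 2 / (2 * l) * B), max N₀ (E / l), ?_⟩
  intro N n r x y hn hN hr hrR hA hb
  have hn1 : 1 ≤ n := by rw [hn]; linarith [(Nat.cast_nonneg N : (0 : ℝ) ≤ N)]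
  have hn0 : 0 < n := by linarith
  have hnδ := Real.rpow_pos_of_pos hn0 δ
  have hEn : E ≤ n * l := by
    have := (le_max_right N₀ (E / l)).trans hN
    rwa [div_le_iff₀ hl] at this
  set A := ‖x + y‖ ^ 2 / 4 with hAd
  have hA2 : A ≤ 2 * n := by linarith [(abs_le.1 hA).1]
  have hk := hmom N n A hn ((le_max_left _ _).trans hN) (by positivity) hA2 hA
  have h1 := hasSum_fermiKernel_succ N x y
  rw [← hAd, hb, ← hP] at h1
  have h2 := hasSum_sineKernel d hr
  rw [← hP] at h2
  have h3 := ((h1.mul_left (n ^ δ)).mul_left (1 / ((l / 2) ^ δ * n ^ d))).sub h2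
  have hbound := (Real.summable_pow_div_factorial (R ^ 2 / (2 * l) * B)).hasSum
  have hexp : ∑' k : ℕ, (R ^ 2 / (2 * l) * B) ^ k / (k.factorial : ℝ) =
      Real.exp (R ^ 2 / (2 * l) * B) := by
    rw [Real.exp_eq_exp_ℝ, NormedSpace.exp_eq_tsum_div]
  rw [hexp] at hbound
  have h4 := h3.norm_le_of_bounded (hbound.mul_left (P * (L / (l / 2) ^ δ) / n)) fun k => ?_
  · rw [Real.norm_eq_abs] at h4
    refine h4.trans (le_of_eq ?_)
    ring
  have hnd : n ^ d = n ^ δ * n ^ δ := by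
    rw [← Real.rpow_add hn0, hδ, add_halves, Real.rpow_natCast]
  have hmain : (n * l / 2) ^ δ = n ^ δ * (l / 2) ^ δ := by
    rw [← Real.mul_rpow hn0.le (by positivity)]; congr 1; ring
  have hG : Real.Gamma ((k : ℝ) + δ + 1) ≠ 0 :=
    (Real.Gamma_pos_of_pos (by positivity)).ne'
  have e1 : 1 / ((l / 2) ^ δ * n ^ d) * (n ^ δ * (P * ((-(r ^ 2 / (2 * l * n))) ^ k /
      (k.factorial : ℝ) * moment d N (k + 3) A))) - P * ((-(r ^ 2)) ^ k / (k.factorial : ℝ) /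
        Real.Gamma (k + δ + 1)) = P * (1 / ((l / 2) ^ δ * n ^ δ)) *
      ((-(r ^ 2 / (2 * l * n))) ^ k / (k.factorial : ℝ)) * (moment d N (k + 3) A -
        (n * l / 2) ^ δ * (2 * n * l) ^ k / Real.Gamma (k + δ + 1)) := by
    have e2 : (-(r ^ 2)) ^ k = (-(r ^ 2 / (2 * l * n))) ^ k * (2 * n * l) ^ k := by
      rw [← mul_pow]; congr 1; field_simp
    rw [e2, hmain, hnd]
    field_simp
  rw [e1, Real.norm_eq_abs, abs_mul, abs_mul, abs_div, abs_pow, abs_neg,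
    abs_of_nonneg (by positivity : 0 ≤ P * (1 / ((l / 2) ^ δ * n ^ δ))),
    abs_of_nonneg (by positivity : 0 ≤ r ^ 2 / (2 * l * n)), Nat.abs_cast]
  have hr2 : r ^ 2 / (2 * l * n) ≤ R ^ 2 / (2 * l * n) := by gcongr
  calc P * (1 / ((l / 2) ^ δ * n ^ δ)) * ((r ^ 2 / (2 * l * n)) ^ k / (k.factorial : ℝ)) *
        |moment d N (k + 3) A - (n * l / 2) ^ δ * (2 * n * l) ^ k / Real.Gamma (k + δ + 1)|
      ≤ P * (1 / ((l / 2) ^ δ * n ^ δ)) * ((R ^ 2 / (2 * l * n)) ^ k / (k.factorial : ℝ)) *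
        (L * (B * n) ^ k * n ^ (δ - 1)) := by
        gcongr
        exact hk k
    _ = P * (L / (l / 2) ^ δ) / n * ((R ^ 2 / (2 * l) * B) ^ k / (k.factorial : ℝ)) := by
        have e3 : (R ^ 2 / (2 * l) * B) ^ k = (R ^ 2 / (2 * l * n)) ^ k * (B * n) ^ k := by
          rw [← mul_pow]; congr 1; field_simp
        rw [e3, Real.rpow_sub_one hn0.ne']
        field_simp

end FermiKernel

theorem mainTheorem4 (d : ℕ) (hd : 1 ≤ d) (X : EuclideanSpace ℝ (Fin d)) (hX : ‖X‖ < √2)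
    (K : Set (EuclideanSpace ℝ (Fin d) × EuclideanSpace ℝ (Fin d))) (hK : IsCompact K) :
    ∃ C : ℝ, ∃ N : ℕ, 1 ≤ N ∧ ∀ n : ℕ, N ≤ n → ∀ U V : EuclideanSpace ℝ (Fin d), (U, V) ∈ K →
      |1 / (bulkNu X * (n : ℝ) ^ d) *
          scaledFermiKernel n
            (X + (1 / (bulkNu X ^ (1 / (d : ℝ)) * (n : ℝ))) • U)
            (X + (1 / (bulkNu X ^ (1 / (d : ℝ)) * (n : ℝ))) • V)
        - sineKernel d ‖U - V‖| ≤ C / (n : ℝ) := by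
  have hX2 : ‖X‖ ^ 2 < 2 := by
    rw [← Real.sq_sqrt (zero_le_two (α := ℝ))]
    exact pow_lt_pow_left₀ hX (norm_nonneg _) two_ne_zero
  obtain ⟨R₀, hR₀⟩ := hK.isBounded.exists_norm_le
  set R := max R₀ 0 with hR
  have hR0 : 0 ≤ R := le_max_right _ _
  set l : ℝ := 1 - ‖X‖ ^ 2 / 2 with hl
  have hl0 : 0 < l := by rw [hl]; linarith
  have hl1 : l ≤ 1 := by rw [hl]; linarith [sq_nonneg ‖X‖]
  set s : ℝ := √(l / 2) with hs
  have hs0 : 0 < s := Real.sqrt_pos.2 (by positivity)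
  have hss : s ^ 2 = l / 2 := Real.sq_sqrt (by positivity)
  -- With `x + y = 2 √n (X + W)` and `‖W‖ ≤ R / (s n)`, this bounds `n / 2 * |‖X‖ ^ 2 - ‖X + W‖ ^
  -- 2|`.
  set E : ℝ := R / s * (2 * ‖X‖ + R / s) / 2 with hE
  obtain ⟨C, N₀, hmain⟩ := FermiKernel.scaledFermiKernel_sub_sineKernel_le (R := 2 * R) hd hl0 hl1
    (by positivity : 0 ≤ E)
  refine ⟨C, max 1 ⌈N₀⌉₊, le_max_left _ _, fun n hn U V hUV => ?_⟩
  have hn1 : 1 ≤ n := (le_max_left _ _).trans hn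
  have hnN : N₀ ≤ n := (Nat.le_ceil N₀).trans (by exact_mod_cast (le_max_right _ _).trans hn)
  have hn0 : (0 : ℝ) < n := by exact_mod_cast hn1
  have hUVR := (hR₀ _ hUV).trans (le_max_left R₀ 0)
  rw [Prod.norm_def] at hUVR
  have hU : ‖U‖ ≤ R := (le_max_left _ _).trans hUVR
  have hV : ‖V‖ ≤ R := (le_max_right _ _).trans hUVR
  rw [FermiKernel.bulkNu_rpow_inv hd hX, FermiKernel.bulkNu_eq hX, ← hl, ← hs, scaledFermiKernel]
  set ε : ℝ := 1 / (s * n) with hε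
  have hε0 : 0 < ε := by positivity
  obtain ⟨N, rfl⟩ := Nat.exists_eq_add_of_le' hn1
  refine hmain N _ _ _ _ (by push_cast; rfl) hnN (norm_nonneg _) ?_ ?_ ?_
  · linarith [norm_sub_le U V]
  · set n : ℝ := ((N + 1 : ℕ) : ℝ) with hnd
    set W := (ε / 2) • (U + V) with hW
    have e1 : √n • (X + ε • U) + √n • (X + ε • V) = (2 * √n) • (X + W) := by
      rw [hW]; module
    have hWn : ‖W‖ ≤ R / s / n := by
      rw [hW, norm_smul, Real.norm_of_nonneg (by positivity)]
      calc ε / 2 * ‖U + V‖ ≤ ε / 2 * (R + R) := by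
            gcongr; exact (norm_add_le U V).trans (add_le_add hU hV)
        _ = R / s / n := by rw [hε]; field_simp; ring
    have hWn' : ‖W‖ ≤ R / s := hWn.trans (div_le_self (by positivity) (Nat.one_le_cast.2 hn1))
    have e2 : |‖X‖ - ‖X + W‖| ≤ ‖W‖ := by
      have := abs_norm_sub_norm_le X (X + W)
      rwa [sub_add_cancel_left, norm_neg] at this
    rw [e1, norm_smul, Real.norm_of_nonneg (by positivity), mul_pow, mul_pow,
      Real.sq_sqrt hn0.le]
    have e3 : n - 2 ^ 2 * n * ‖X + W‖ ^ 2 / 4 / 2 - n * l =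
        n / 2 * ((‖X‖ - ‖X + W‖) * (‖X‖ + ‖X + W‖)) := by rw [hl]; ring
    rw [e3, abs_mul, abs_mul, abs_of_pos (by positivity : 0 < n / 2),
      abs_of_nonneg (by positivity : 0 ≤ ‖X‖ + ‖X + W‖)]
    have e4 : ‖X‖ + ‖X + W‖ ≤ 2 * ‖X‖ + R / s := by linarith [norm_add_le X W]
    calc n / 2 * (|‖X‖ - ‖X + W‖| * (‖X‖ + ‖X + W‖))
        ≤ n / 2 * (R / s / n * (2 * ‖X‖ + R / s)) := by
          have e5 := e2.trans hWn
          gcongr n / 2 * (?_ * ?_)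
      _ = E := by rw [hE]; field_simp
  · set n : ℝ := ((N + 1 : ℕ) : ℝ) with hnd
    have e1 : √n • (X + ε • U) - √n • (X + ε • V) = (√n * ε) • (U - V) := by module
    rw [e1, norm_smul, Real.norm_of_nonneg (by positivity), mul_pow, mul_pow,
      Real.sq_sqrt hn0.le, hε, div_pow, mul_pow, hss]
    field_simp
    ring
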